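/- Fix $r\in[2,3)$ and $d,d'\in\mathbb N$. For $T\ge 0$ and $p>0$, the $p$-variation of a two-parameter function $\Xi$ on $\{(s,t): 0\le s\le t\le T\}$ is $\|\Xi\|_p=\sup\bigl(\sum_{j}|\Xi_{u_j,u_{j+1}}|^p\bigr)^{1/p}$, the supremum being over all finite sequences $0\le u_0\le\dots\le u_J\le T$; for a path $f$ on $[0,T]$, $\|f\|_p$ is the $p$-variation of $(s,t)\mapsto f_t-f_s$. An $r$-rough path $\mathbf X=(X,\mathbb X)$ on $[0,T]$ consists of $X:[0,T]\to\mathbb R^d$ and $\mathbb X:\{0\le s\le t\le T\}\to\mathbb R^{d\times d}$ with $\|X\|_r<\infty$, $\|\mathbb X\|_{r/2}<\infty$ and $\mathbb X_{s,u}=\mathbb X_{s,t}+\mathbb X_{t,u}+(X_t-X_s)\otimes(X_u-X_t)$ for $s<t<u$. An $\mathbf X$-controlled path in a normed space $E$ is a pair $\mathbf Y=(Y,Y')$, $Y:[0,T]\to E$, $Y':[0,T]\to L(\mathbb R^d,E)$, with $\|Y'\|_r<\infty$ and $\|R^Y\|_{r/2}<\infty$, where $R^Y_{s,t}=Y_t-Y_s-Y'_s(X_t-X_s)$.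 For paths $Z:[0,T]\to L(\mathbb R^d,\mathbb R^{d'})$ and $Z':[0,T]\to L(\mathbb R^d,L(\mathbb R^d,\mathbb R^{d'}))$, the rough integral $\int_0^t(Z,Z')\,d\mathbf X$ is the limit, along the partitions $0=\pi_0<\dots<\pi_J=t$ directed by inclusion, of $\sum_j \bigl(Z_{\pi_{j-1}}(X_{\pi_j}-X_{\pi_{j-1}})+Z'_{\pi_{j-1}}\mathbb X_{\pi_{j-1},\pi_j}\bigr)$, where $L\in L(\mathbb R^d,L(\mathbb R^d,\mathbb R^{d'}))$ acts on $\mathbb R^{d\times d}$ linearly by $L(a\otimes b)=(La)b$. **Theorem.** Let $\varphi:\mathbb R^{d'}\to L(\mathbb R^d,\mathbb R^{d'})$ be twice differentiable with $\varphi,D\varphi,D^2\varphi$ bounded and $D^2\varphi$ Lipschitz. Then there exist $A\in(0,\infty)$ and $\epsilon>0$ (depending only on $r,d,d',\varphi$) such that, for every $T\ge0$, every $r$-rough path $\mathbf X=(X,\mathbb X)$ on $[0,T]$ with values in $\mathbb R^d$ with $\|X\|_r<\epsilon$ and $\|\mathbb X\|_{r/2}<\epsilon$, and every $y_0\in\mathbb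 R^{d'}$, there is a unique $\mathbf X$-controlled path $\mathbf Y=(Y,Y')$ in $\mathbb R^{d'}$ that belongs to $$\mathcal Y(\mathbf X,A)=\bigl\{\mathbf Y:\ \|Y'\|_r\le A,\ \|R^Y\|_{r/2}\le A^2,\ \|Y\|_r\le A/\|\varphi\|_{\mathrm{Lip}},\ \|Y'\|_{\sup}\le\|\varphi\|_{\sup}\bigr\}$$ (with $A/0=\infty$) and satisfies, for every $t\in[0,T]$, $$Y_t=y_0+\int_0^t\varphi(\mathbf Y)\,d\mathbf X,\qquad Y'_t=\varphi(Y_t),$$ where $\varphi(\mathbf Y)=(\varphi(Y),D\varphi(Y)Y')$; the existence of the integrals is part of the assertion. -/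

import Mathlib

open Set Filter Topology
open scoped ENNReal NNReal

/-- The `p`-variation (over all of `ι`) of a two-parameter function `Ξ`, with values in `[0, ∞]`:
the supremum over all finite sequences `u 0 ≤ u 1 ≤ ⋯ ≤ u n` of
`(∑ j < n, |Ξ (u j) (u (j+1))| ^ p) ^ (1/p)`.
Only the values `Ξ s t` with `s ≤ t` matter. -/
noncomputable def pVar₂ {ι E : Type*} [LinearOrder ι] [NormedAddCommGroup E]
    (p : ℝ) (Ξ : ι → ι → E) : ℝ≥0∞ :=
  ⨆ (u : ℕ → ι) (_ : Monotone u) (n : ℕ),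
    (∑ j ∈ Finset.range n, ‖Ξ (u j) (u (j + 1))‖ₑ ^ p) ^ (1 / p)

/-- The `p`-variation of a path, i.e. of its increments `f t - f s`. -/
noncomputable def pVar {ι E : Type*} [LinearOrder ι] [NormedAddCommGroup E]
    (p : ℝ) (f : ι → E) : ℝ≥0∞ :=
  pVar₂ p (fun s t => f t - f s)

/-- The supremum norm, with values in `[0, ∞]`. -/
noncomputable def supNorm {α E : Type*} [NormedAddCommGroup E] (f : α → E) : ℝ≥0∞ :=
  ⨆ x, ‖f x‖ₑ

/-- The best Lipschitz constant, with values in `[0, ∞]` (the pairs `x = y` contribute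
`0 / 0 = 0`). -/
noncomputable def lipNorm {E F : Type*} [NormedAddCommGroup E] [NormedAddCommGroup F]
    (f : E → F) : ℝ≥0∞ :=
  ⨆ (x : E) (y : E), ‖f x - f y‖ₑ / ‖x - y‖ₑ

/-- The class `C^{2,1}_b`: twice differentiable functions `φ` with `φ`, `Dφ`, `D²φ` bounded
and `D²φ` Lipschitz. -/
structure IsC21b {E F : Type*} [NormedAddCommGroup E] [NormedSpace ℝ E]
    [NormedAddCommGroup F] [NormedSpace ℝ F] (φ : E → F) : Prop where
  differentiable : Differentiable ℝ φ
  differentiable_fderiv : Differentiable ℝ (fderiv ℝ φ)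
  bounded : ∃ C : ℝ, ∀ x, ‖φ x‖ ≤ C
  bounded_fderiv : ∃ C : ℝ, ∀ x, ‖fderiv ℝ φ x‖ ≤ C
  bounded_fderiv₂ : ∃ C : ℝ, ∀ x, ‖fderiv ℝ (fderiv ℝ φ) x‖ ≤ C
  lipschitz_fderiv₂ : ∃ K : ℝ≥0, LipschitzWith K (fderiv ℝ (fderiv ℝ φ))

/-- The tensor product `a ⊗ b` of two vectors of `ℝ^d`, as an element of `ℝ^{d × d}`. -/
noncomputable def outer {d : ℕ} (a b : EuclideanSpace ℝ (Fin d)) :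
    EuclideanSpace ℝ (Fin d × Fin d) :=
  WithLp.toLp 2 (fun k => a k.1 * b k.2)

/-- The action of `L ∈ L(ℝ^d, L(ℝ^d, F))` on `ℝ^{d × d}`: the linear map determined by
`a ⊗ b ↦ (L a) b`. -/
noncomputable def tensorApply {d : ℕ} {F : Type*} [NormedAddCommGroup F] [NormedSpace ℝ F]
    (L : EuclideanSpace ℝ (Fin d) →L[ℝ] (EuclideanSpace ℝ (Fin d) →L[ℝ] F))
    (M : EuclideanSpace ℝ (Fin d × Fin d)) : F :=
  ∑ i, ∑ j, M (i, j) • L (EuclideanSpace.single i 1) (EuclideanSpace.single j 1)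

/-- An `r`-rough path on `[0, T]` with values in `ℝ^d`. The second component is a function on
`{(s, t) | s ≤ t}`; its values at `s > t` are never used. -/
structure RoughPath (r T : ℝ) (d : ℕ) where
  /-- the path `X` -/
  path : Icc (0 : ℝ) T → EuclideanSpace ℝ (Fin d)
  /-- the second order process `𝕏` -/
  area : Icc (0 : ℝ) T → Icc (0 : ℝ) T → EuclideanSpace ℝ (Fin d × Fin d)
  path_var : pVar r path < ∞
  area_var : pVar₂ (r / 2) area < ∞
  chen : ∀ s t u, s < t → t < u →
    area s u = area s t + area t u + outer (path t - path s) (path u - path t)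

/-- The remainder `R_{s,t} = Y_t - Y_s - Y'_s (X_t - X_s)`. -/
def remainder {r T : ℝ} {d : ℕ} {E : Type*} [NormedAddCommGroup E] [NormedSpace ℝ E]
    (X : RoughPath r T d) (Y : Icc (0 : ℝ) T → E)
    (Y' : Icc (0 : ℝ) T → (EuclideanSpace ℝ (Fin d) →L[ℝ] E))
    (s t : Icc (0 : ℝ) T) : E :=
  Y t - Y s - Y' s (X.path t - X.path s)

/-- An `X`-controlled `r`-rough path `(Y, Y')` with values in `E`. -/
structure ControlledPath {r T : ℝ} {d : ℕ} (X : RoughPath r T d)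
    (E : Type*) [NormedAddCommGroup E] [NormedSpace ℝ E] where
  /-- the path `Y` -/
  path : Icc (0 : ℝ) T → E
  /-- the derivative `Y'` -/
  deriv : Icc (0 : ℝ) T → (EuclideanSpace ℝ (Fin d) →L[ℝ] E)
  deriv_var : pVar r deriv < ∞
  remainder_var : pVar₂ (r / 2) (remainder X path deriv) < ∞

/-- The partitions of `[a, b]`, as finite sets of points that contain both endpoints.
They are ordered by inclusion. -/
abbrev IntervalPartition {ι : Type*} [LinearOrder ι] (a b : ι) : Type _ :=
  {π : Finset ι // a ∈ π ∧ b ∈ π ∧ ∀ x ∈ π, a ≤ x ∧ x ≤ b}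

/-- The sum `∑ j, Ξ (π_{j-1}) (π_j)` over the consecutive points `π_0 < ⋯ < π_J` of `π`. -/
def partitionSum {ι E : Type*} [LinearOrder ι] [AddCommMonoid E]
    (Ξ : ι → ι → E) (π : Finset ι) : E :=
  (List.zipWith Ξ (π.sort (· ≤ ·)) (π.sort (· ≤ ·)).tail).sum

/-- `HasRoughIntegral X Z Z' a b I` says that `∫_a^b (Z, Z') d(X, 𝕏)` exists and equals `I`:
the sums of `Ξ_{s,t} = Z_s (X_t - X_s) + Z'_s 𝕏_{s,t}` converge to `I` along the partitions
of `[a, b]` directed by inclusion. -/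
def HasRoughIntegral {r T : ℝ} {d : ℕ} {F : Type*} [NormedAddCommGroup F] [NormedSpace ℝ F]
    (X : RoughPath r T d)
    (Z : Icc (0 : ℝ) T → (EuclideanSpace ℝ (Fin d) →L[ℝ] F))
    (Z' : Icc (0 : ℝ) T →
      (EuclideanSpace ℝ (Fin d) →L[ℝ] (EuclideanSpace ℝ (Fin d) →L[ℝ] F)))
    (a b : Icc (0 : ℝ) T) (I : F) : Prop :=
  Tendsto
    (fun π : IntervalPartition a b =>
      partitionSum
        (fun s t => Z s (X.path t - X.path s) + tensorApply (Z' s) (X.area s t)) π.1)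
    atTop (𝓝 I)

/-- The class `𝒴(X, A)` of `X`-controlled paths with `‖Y'‖_r ≤ A`, `‖R^Y‖_{r/2} ≤ A²`,
`‖Y‖_r ≤ A / ‖φ‖_Lip` and `‖Y'‖_sup ≤ ‖φ‖_sup`. Here `A / 0 = ∞` for `A > 0`. -/
def solutionSpace {r T : ℝ} {d d' : ℕ}
    (φ : EuclideanSpace ℝ (Fin d') →
      (EuclideanSpace ℝ (Fin d) →L[ℝ] EuclideanSpace ℝ (Fin d')))
    (X : RoughPath r T d) (A : ℝ≥0) :
    Set (ControlledPath X (EuclideanSpace ℝ (Fin d'))) :=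
  {Y | pVar r Y.deriv ≤ A ∧
    pVar₂ (r / 2) (remainder X Y.path Y.deriv) ≤ (A : ℝ≥0∞) ^ 2 ∧
    pVar r Y.path ≤ (A : ℝ≥0∞) / lipNorm φ ∧
    supNorm Y.deriv ≤ supNorm φ}

/-- `(Y, Y')` solves `Y_t = y₀ + ∫_0^t φ(Y) dX`, `Y'_t = φ(Y_t)` for all `t ∈ [0, T]`, where
`φ(Y)` is the controlled path `(φ(Y), Dφ(Y) Y')`. The existence of the integrals is part of
the condition. -/
def IsRDESolution {r T : ℝ} (hT : 0 ≤ T) {d d' : ℕ}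
    (φ : EuclideanSpace ℝ (Fin d') →
      (EuclideanSpace ℝ (Fin d) →L[ℝ] EuclideanSpace ℝ (Fin d')))
    (X : RoughPath r T d) (y₀ : EuclideanSpace ℝ (Fin d'))
    (Y : ControlledPath X (EuclideanSpace ℝ (Fin d'))) : Prop :=
  ∀ t : Icc (0 : ℝ) T,
    (∃ I : EuclideanSpace ℝ (Fin d'),
      HasRoughIntegral X (fun s => φ (Y.path s))
        (fun s => (fderiv ℝ φ (Y.path s)).comp (Y.deriv s)) ⟨0, le_rfl, hT⟩ t I ∧
      Y.path t = y₀ + I) ∧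
    Y.deriv t = φ (Y.path t)

/-!
The solutions are the fixed points of the Picard map
`(Y, Y') ↦ (y₀ + ∫ φ(Y) dX, φ(Y))`, and the proof shows that this map is a contraction.

All regularity is measured by controls, i.e. superadditive functions `ω(s, t)`. The finite variation
norms of a rough path give one control `ω` with `‖X_{s,t}‖ ≤ ω(s,t)^{1/r}` and
`‖𝕏_{s,t}‖ ≤ ω(s,t)^{2/r}`, which is uniformly small if the norms are
(`RoughPath.exists_dominatedBy`). The path may have jumps, so `ω` need not be continuous, and a fine
mesh does not make `ω` small on the intervals of a partition. The sewing lemma `exists_sewing` works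
without continuity: the defect of additivity at `s ≤ t ≤ u` carries a factor
`min (ω s t) (ω t u) ^ σ`, and an interval can be cut finitely often so that in every piece one
of any two adjacent intervals has small control (`exists_partition_norm_sub_le`). Its quantitative
part follows by repeated bisection of the control (`norm_sum_sub_le`). Chen's relation provides
the defect bound for the compensated Riemann sums (`norm_roughGerm_sub_sub_le`), where
`3 / r > 1` is used.

Consider the paths with `‖Y'_{s,t}‖ ≤ B ω^{1/r}` and `‖R_{s,t}‖ ≤ B ω^{2/r}`. For a suitable `B` and
small `ω`, the Picard map preserves this class (`IsControlledBy.exists_picardStep`) and halves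
distances in it (`IsPicardStep.isCloseBy`); for the contraction, the difference of two compositions
with `φ` is estimated by Taylor expansion, which uses that `D²φ` is Lipschitz. Hence there
is exactly one fixed point in this class (`exists_isPicardStep_self`, `IsPicardStep.unique`).

The solution space is larger, since it bounds only the total variation of `Y'` and `R`. The a priori
estimate `IsPicardStep.isControlledBy` closes the gap: a solution whose remainder has small
`r/2`-variation already has its remainder dominated by a multiple of `ω`, and so lies in the class
above. This is where `A` has to be small; `ω` is then taken small in terms of `A`, which places the
fixed point in the solution space.
-/

/-! ### Controls and `p`-variation -/

/-- A control: a nonnegative function that is superadditive on `s ≤ t ≤ u`. No continuity is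
required, so that paths with jumps are covered. -/
structure IsControl {ι : Type*} [LinearOrder ι] (ω : ι → ι → ℝ) : Prop where
  nonneg : ∀ s t, 0 ≤ ω s t
  superadd : ∀ s t u, s ≤ t → t ≤ u → ω s t + ω t u ≤ ω s u

namespace IsControl

variable {ι : Type*} [LinearOrder ι] {ω ω' : ι → ι → ℝ}

lemma self_eq_zero (h : IsControl ω) (t : ι) : ω t t = 0 := by
  have h1 := h.superadd t t t le_rfl le_rfl
  have h2 := h.nonneg t t
  linarith

lemma mono (h : IsControl ω) {s s' t' t : ι} (h1 : s ≤ s') (h2 : s' ≤ t') (h3 : t' ≤ t) :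
    ω s' t' ≤ ω s t := by
  have a := h.superadd s s' t h1 (h2.trans h3)
  have b := h.superadd s' t' t h2 h3
  have c := h.nonneg s s'
  have d := h.nonneg t' t
  linarith

lemma add (h : IsControl ω) (h' : IsControl ω') : IsControl (fun s t => ω s t + ω' s t) where
  nonneg s t := add_nonneg (h.nonneg s t) (h'.nonneg s t)
  superadd s t u h1 h2 := by
    have a := h.superadd s t u h1 h2
    have b := h'.superadd s t u h1 h2
    linarith

lemma const_mul (h : IsControl ω) {c : ℝ} (hc : 0 ≤ c) : IsControl (fun s t => c * ω s t) where
  nonneg s t := mul_nonneg hc (h.nonneg s t)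
  superadd s t u h1 h2 := by
    have a := mul_le_mul_of_nonneg_left (h.superadd s t u h1 h2) hc
    linarith

lemma sum_le (h : IsControl ω) {u : ℕ → ι} (hu : Monotone u) (n : ℕ) :
    ∑ j ∈ Finset.range n, ω (u j) (u (j + 1)) ≤ ω (u 0) (u n) := by
  induction n with
  | zero => simpa using h.nonneg _ _
  | succ n ih =>
    rw [Finset.sum_range_succ]
    have := h.superadd (u 0) (u n) (u (n + 1)) (hu (Nat.zero_le _)) (hu (Nat.le_succ _))
    linarith

end IsControl

/-- The finite monotone sequences in `[s, t]`, encoded as an infinite monotone sequence together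
with the index of the last point that is used. -/
abbrev MonotoneSeqIn {ι : Type*} [LinearOrder ι] (s t : ι) : Type _ :=
  {q : (ℕ → ι) × ℕ // Monotone q.1 ∧ s ≤ q.1 0 ∧ q.1 q.2 ≤ t}

/-- The `p`-th power of the `p`-variation of `Ξ` on `[s, t]`, with values in `[0, ∞]`. -/
noncomputable def eVarControl {ι E : Type*} [LinearOrder ι] [NormedAddCommGroup E]
    (p : ℝ) (Ξ : ι → ι → E) (s t : ι) : ℝ≥0∞ :=
  ⨆ q : MonotoneSeqIn s t, ∑ j ∈ Finset.range q.1.2, ‖Ξ (q.1.1 j) (q.1.1 (j + 1))‖ₑ ^ p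

/-- The `p`-th power of the `p`-variation of `Ξ` on `[s, t]`, as a real number. When `Ξ` has finite
`p`-variation, this is the least control that dominates `‖Ξ s t‖ ^ p`. -/
noncomputable def varControl {ι E : Type*} [LinearOrder ι] [NormedAddCommGroup E]
    (p : ℝ) (Ξ : ι → ι → E) (s t : ι) : ℝ :=
  (eVarControl p Ξ s t).toReal

section varControl

variable {ι E : Type*} [LinearOrder ι] [NormedAddCommGroup E] {p : ℝ} {Ξ : ι → ι → E}

lemma eVarControl_le (hp : 0 < p) (s t : ι) : eVarControl p Ξ s t ≤ pVar₂ p Ξ ^ p := by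
  refine iSup_le fun q => ?_
  have h : (∑ j ∈ Finset.range q.1.2, ‖Ξ (q.1.1 j) (q.1.1 (j + 1))‖ₑ ^ p) ^ (1 / p)
      ≤ pVar₂ p Ξ :=
    le_iSup_of_le q.1.1 (le_iSup_of_le q.2.1 (le_iSup_of_le q.1.2 le_rfl))
  have h' := ENNReal.rpow_le_rpow h hp.le
  rwa [← ENNReal.rpow_mul, one_div_mul_cancel hp.ne', ENNReal.rpow_one] at h'

lemma eVarControl_superadd {s t u : ι} (h1 : s ≤ t) (h2 : t ≤ u) :
    eVarControl p Ξ s t + eVarControl p Ξ t u ≤ eVarControl p Ξ s u := by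
  have : Nonempty (MonotoneSeqIn s t) := ⟨⟨(fun _ => s, 0), monotone_const, le_rfl, h1⟩⟩
  have : Nonempty (MonotoneSeqIn t u) := ⟨⟨(fun _ => t, 0), monotone_const, le_rfl, h2⟩⟩
  refine ENNReal.iSup_add_iSup_le ?_
  rintro ⟨⟨v, n⟩, hv, hv0, hvn⟩ ⟨⟨v', m⟩, hv', hv0', hvm'⟩
  dsimp only at *
  -- The concatenation passes from `v n ≤ t` to `v' 0 ≥ t` by one additional step.
  set x : ℕ → ι := fun j => if j ≤ n then v j else v' (j - (n + 1)) with hx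
  have hxmono : Monotone x := by
    intro i j hij
    simp only [hx]
    split_ifs with hi hj hj
    · exact hv hij
    · exact (hv hi).trans (hvn.trans (hv0'.trans (hv' (Nat.zero_le _))))
    · omega
    · exact hv' (by omega)
  have hx0 : x 0 = v 0 := by simp [hx]
  have hxe : x (n + 1 + m) = v' m := by
    simp only [hx]
    rw [if_neg (by omega)]
    congr 1
    omega
  refine le_trans ?_ (le_iSup (fun q : MonotoneSeqIn s u =>
    ∑ j ∈ Finset.range q.1.2, ‖Ξ (q.1.1 j) (q.1.1 (j + 1))‖ₑ ^ p)
    ⟨(x, n + 1 + m), hxmono, by simpa [hx0] using hv0, by simpa [hxe] using hvm'⟩)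
  dsimp only
  rw [Finset.sum_range_add _ (n + 1) m, Finset.sum_range_succ]
  refine add_le_add (le_trans (le_of_eq ?_) le_self_add) (le_of_eq ?_)
  · refine Finset.sum_congr rfl fun j hj => ?_
    have hj' := Finset.mem_range.1 hj
    simp only [hx]
    rw [if_pos hj'.le, if_pos (by omega)]
  · refine Finset.sum_congr rfl fun j hj => ?_
    simp only [hx]
    rw [if_neg (by omega), if_neg (by omega)]
    congr 4 <;> omega

lemma le_eVarControl {s t : ι} (h : s ≤ t) : ‖Ξ s t‖ₑ ^ p ≤ eVarControl p Ξ s t := by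
  set x : ℕ → ι := fun j => if j = 0 then s else t with hx
  have hxmono : Monotone x := by
    intro i j hij
    simp only [hx]
    split_ifs with hi hj hj
    · exact le_rfl
    · exact h
    · omega
    · exact le_rfl
  refine le_trans ?_ (le_iSup (fun q : MonotoneSeqIn s t =>
    ∑ j ∈ Finset.range q.1.2, ‖Ξ (q.1.1 j) (q.1.1 (j + 1))‖ₑ ^ p)
    ⟨(x, 1), hxmono, by simp [hx], by simp [hx]⟩)
  simp [hx]

lemma eVarControl_lt_top (hp : 0 < p) (h : pVar₂ p Ξ < ∞) (s t : ι) : eVarControl p Ξ s t < ∞ :=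
  (eVarControl_le hp s t).trans_lt (ENNReal.rpow_lt_top_of_nonneg hp.le h.ne)

lemma isControl_varControl (hp : 0 < p) (h : pVar₂ p Ξ < ∞) : IsControl (varControl p Ξ) where
  nonneg _ _ := ENNReal.toReal_nonneg
  superadd s t u h1 h2 := by
    unfold varControl
    rw [← ENNReal.toReal_add (eVarControl_lt_top hp h _ _).ne (eVarControl_lt_top hp h _ _).ne]
    exact ENNReal.toReal_mono (eVarControl_lt_top hp h _ _).ne (eVarControl_superadd h1 h2)

lemma norm_le_varControl (hp : 0 < p) (h : pVar₂ p Ξ < ∞) {s t : ι} (hst : s ≤ t) :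
    ‖Ξ s t‖ ≤ varControl p Ξ s t ^ (1 / p) := by
  have h1 := ENNReal.toReal_mono (eVarControl_lt_top hp h s t).ne (le_eVarControl (Ξ := Ξ) hst)
  rw [← ENNReal.toReal_rpow, toReal_enorm] at h1
  have h2 := Real.rpow_le_rpow (Real.rpow_nonneg (norm_nonneg _) _) h1 (one_div_nonneg.2 hp.le)
  rwa [← Real.rpow_mul (norm_nonneg _), mul_one_div_cancel hp.ne', Real.rpow_one] at h2

lemma varControl_le_rpow (hp : 0 < p) {b : ℝ} (hb : 0 ≤ b) (h : pVar₂ p Ξ ≤ ENNReal.ofReal b)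
    (s t : ι) : varControl p Ξ s t ≤ b ^ p := by
  have h1 : eVarControl p Ξ s t ≤ ENNReal.ofReal (b ^ p) := by
    rw [← ENNReal.ofReal_rpow_of_nonneg hb hp.le]
    exact (eVarControl_le hp s t).trans (ENNReal.rpow_le_rpow h hp.le)
  exact ENNReal.toReal_le_of_le_ofReal (Real.rpow_nonneg hb _) h1

lemma sum_enorm_rpow_le (hp : 0 < p) {ω : ι → ι → ℝ} (hω : IsControl ω)
    (hΞ : ∀ s t, s ≤ t → ‖Ξ s t‖ ≤ ω s t ^ (1 / p)) {u : ℕ → ι} (hu : Monotone u) (n : ℕ) :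
    ∑ j ∈ Finset.range n, ‖Ξ (u j) (u (j + 1))‖ₑ ^ p ≤ ENNReal.ofReal (ω (u 0) (u n)) := by
  have h1 : ∀ s t, s ≤ t → ‖Ξ s t‖ₑ ^ p ≤ ENNReal.ofReal (ω s t) := by
    intro s t hst
    rw [← ofReal_norm, ENNReal.ofReal_rpow_of_nonneg (norm_nonneg _) hp.le]
    refine ENNReal.ofReal_le_ofReal ?_
    have := Real.rpow_le_rpow (norm_nonneg _) (hΞ s t hst) hp.le
    rwa [← Real.rpow_mul (hω.nonneg _ _), one_div_mul_cancel hp.ne', Real.rpow_one] at this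
  calc _ ≤ ∑ j ∈ Finset.range n, ENNReal.ofReal (ω (u j) (u (j + 1))) :=
        Finset.sum_le_sum fun j _ => h1 _ _ (hu (Nat.le_succ _))
    _ = ENNReal.ofReal (∑ j ∈ Finset.range n, ω (u j) (u (j + 1))) :=
        (ENNReal.ofReal_sum_of_nonneg fun _ _ => hω.nonneg _ _).symm
    _ ≤ _ := ENNReal.ofReal_le_ofReal (hω.sum_le hu n)

lemma varControl_le_of_control (hp : 0 < p) {ω : ι → ι → ℝ} (hω : IsControl ω)
    (hΞ : ∀ s t, s ≤ t → ‖Ξ s t‖ ≤ ω s t ^ (1 / p)) (s t : ι) :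
    varControl p Ξ s t ≤ ω s t := by
  refine ENNReal.toReal_le_of_le_ofReal (hω.nonneg _ _) (iSup_le fun q => ?_)
  refine (sum_enorm_rpow_le hp hω hΞ q.2.1 _).trans (ENNReal.ofReal_le_ofReal ?_)
  exact hω.mono q.2.2.1 (q.2.1 (Nat.zero_le _)) q.2.2.2

lemma pVar₂_le_of_control (hp : 0 < p) {ω : ι → ι → ℝ} (hω : IsControl ω)
    (hΞ : ∀ s t, s ≤ t → ‖Ξ s t‖ ≤ ω s t ^ (1 / p)) {b : ℝ}
    (hb : ∀ s t, s ≤ t → ω s t ^ (1 / p) ≤ b) : pVar₂ p Ξ ≤ ENNReal.ofReal b := by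
  refine iSup_le fun u => iSup_le fun hu => iSup_le fun n => ?_
  refine (ENNReal.rpow_le_rpow (sum_enorm_rpow_le hp hω hΞ hu n)
    (one_div_nonneg.2 hp.le)).trans ?_
  rw [ENNReal.ofReal_rpow_of_nonneg (hω.nonneg _ _) (one_div_nonneg.2 hp.le)]
  exact ENNReal.ofReal_le_ofReal (hb _ _ (hu (Nat.zero_le _)))

end varControl

/-! ### Sums over partitions -/

/-- The sum of `Ξ` over the consecutive entries of a list. -/
def consecutiveSum {ι E : Type*} [AddCommMonoid E] (Ξ : ι → ι → E) (l : List ι) : E :=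
  (List.zipWith Ξ l l.tail).sum

lemma consecutiveSum_append {ι E : Type*} [AddCommMonoid E] (Ξ : ι → ι → E) (l₁ : List ι) (c : ι)
    (l₂ : List ι) : consecutiveSum Ξ (l₁ ++ c :: l₂)
      = consecutiveSum Ξ (l₁ ++ [c]) + consecutiveSum Ξ (c :: l₂) := by
  induction l₁ with
  | nil => simp [consecutiveSum]
  | cons a l ih =>
    cases l with
    | nil => simp [consecutiveSum]
    | cons b l =>
      simp only [consecutiveSum, List.cons_append, List.tail_cons, List.zipWith_cons_cons,
        List.sum_cons] at ih ⊢
      rw [ih, add_assoc]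

section partitionSum

variable {ι E : Type*} [LinearOrder ι]

lemma partitionSum_toFinset [AddCommMonoid E] (Ξ : ι → ι → E) {l : List ι}
    (hl : l.Pairwise (· < ·)) : partitionSum Ξ l.toFinset = consecutiveSum Ξ l := by
  have h : l.toFinset.sort (· ≤ ·) = l :=
    (List.toFinset_sort (· ≤ ·) (hl.imp ne_of_lt)).2 (hl.imp le_of_lt)
  rw [partitionSum, consecutiveSum, h]

lemma partitionSum_split [AddCommMonoid E] (Ξ : ι → ι → E) {π : Finset ι} {c : ι} (hc : c ∈ π) :
    partitionSum Ξ π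
      = partitionSum Ξ (π.filter (· ≤ c)) + partitionSum Ξ (π.filter (c ≤ ·)) := by
  obtain ⟨l₁, l₂, hl⟩ := List.append_of_mem ((Finset.mem_sort (s := π) (· ≤ ·)).2 hc)
  have hsort : (l₁ ++ c :: l₂).Pairwise (· < ·) := hl ▸ (Finset.sortedLT_sort π).pairwise
  have hπ : π = (l₁ ++ c :: l₂).toFinset := by rw [← hl, Finset.sort_toFinset]
  have hs := List.pairwise_append.1 hsort
  have hs₂ := List.pairwise_cons.1 hs.2.1
  have h1 : π.filter (· ≤ c) = (l₁ ++ [c]).toFinset := by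
    ext x
    simp only [hπ, Finset.mem_filter, List.mem_toFinset, List.mem_append, List.mem_cons,
      List.not_mem_nil, or_false]
    constructor
    · rintro ⟨h | h | h, hx⟩
      · exact Or.inl h
      · exact Or.inr h
      · exact absurd (hs₂.1 x h) (not_lt.2 hx)
    · rintro (h | h)
      · exact ⟨Or.inl h, (hs.2.2 x h c (by simp)).le⟩
      · exact ⟨Or.inr (Or.inl h), h.le⟩
  have h2 : π.filter (c ≤ ·) = (c :: l₂).toFinset := by
    ext x
    simp only [hπ, Finset.mem_filter, List.mem_toFinset, List.mem_append, List.mem_cons]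
    constructor
    · rintro ⟨h | h | h, hx⟩
      · exact absurd (hs.2.2 x h c (by simp)) (not_lt.2 hx)
      · exact Or.inl h
      · exact Or.inr h
    · rintro (h | h)
      · exact ⟨Or.inr (Or.inl h), h.ge⟩
      · exact ⟨Or.inr (Or.inr h), (hs₂.1 x h).le⟩
  have hs₁ : (l₁ ++ [c]).Pairwise (· < ·) :=
    List.pairwise_append.2 ⟨hs.1, by simp, fun a ha b hb => by
      obtain rfl : b = c := by simpa using hb
      exact hs.2.2 a ha b (by simp)⟩
  rw [h1, h2, partitionSum_toFinset Ξ hs₁, partitionSum_toFinset Ξ hs.2.1, hπ,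
    partitionSum_toFinset Ξ hsort, consecutiveSum_append]

lemma exists_monotone_consecutiveSum [AddCommMonoid E] (Ξ : ι → ι → E) (l : List ι) :
    ∀ a : ι, (a :: l).Pairwise (· ≤ ·) →
      ∃ (u : ℕ → ι) (n : ℕ), Monotone u ∧ u 0 = a ∧ u n ∈ a :: l ∧ (∀ x ∈ a :: l, x ≤ u n) ∧
        (∀ j, u j ≤ u n) ∧
        consecutiveSum Ξ (a :: l) = ∑ j ∈ Finset.range n, Ξ (u j) (u (j + 1)) := by
  induction l with
  | nil =>
    intro a _
    exact ⟨fun _ => a, 0, monotone_const, rfl, by simp, by simp, by simp, by simp [consecutiveSum]⟩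
  | cons b l ih =>
    intro a hal
    obtain ⟨ha, hbl⟩ := List.pairwise_cons.1 hal
    obtain ⟨u, n, hu, hu0, hun, hmax, hmax', hsum⟩ := ih b hbl
    have hab : a ≤ b := ha b (by simp)
    refine ⟨fun j => Nat.casesOn j a u, n + 1, ?_, rfl, List.mem_cons_of_mem _ hun, ?_, ?_, ?_⟩
    · refine monotone_nat_of_le_succ fun j => ?_
      cases j with
      | zero => simpa [hu0] using hab
      | succ j => exact hu (Nat.le_succ _)
    · intro x hx
      rcases List.mem_cons.1 hx with rfl | hx
      · exact hab.trans (hmax b (by simp))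
      · exact hmax x hx
    · intro j
      cases j with
      | zero => exact hab.trans (hmax b (by simp))
      | succ j => exact hmax' j
    · rw [Finset.sum_range_succ', add_comm]
      simp only [consecutiveSum, List.tail_cons, List.zipWith_cons_cons, List.sum_cons] at hsum ⊢
      rw [hsum]
      simp [hu0]

lemma exists_monotone_partitionSum [AddCommMonoid E] (Ξ : ι → ι → E) {a b : ι}
    (π : IntervalPartition a b) :
    ∃ (u : ℕ → ι) (n : ℕ), Monotone u ∧ u 0 = a ∧ u n = b ∧ (∀ j, u j ≤ b) ∧
      partitionSum Ξ π.1 = ∑ j ∈ Finset.range n, Ξ (u j) (u (j + 1)) := by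
  obtain ⟨π, ha, hb, hab⟩ := π
  have hmem : ∀ x, x ∈ π.sort (· ≤ ·) ↔ x ∈ π := fun x => Finset.mem_sort (s := π) (· ≤ ·)
  have hsort := Finset.pairwise_sort π (· ≤ ·)
  rcases hl : π.sort (· ≤ ·) with _ | ⟨c, l⟩
  · have := (hmem a).2 ha
    simp [hl] at this
  · rw [hl] at hsort
    simp only [hl] at hmem
    obtain ⟨u, n, hu, hu0, hun, hmax, hmax', hsum⟩ := exists_monotone_consecutiveSum Ξ l c hsort
    have hca : c = a := by
      refine le_antisymm ?_ (hab c ((hmem c).1 (by simp))).1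
      rcases List.mem_cons.1 ((hmem a).2 ha) with h | h
      · exact h.ge
      · exact (List.pairwise_cons.1 hsort).1 a h
    have hbn : u n = b :=
      le_antisymm (hab _ ((hmem _).1 hun)).2 (hmax b ((hmem b).2 hb))
    refine ⟨u, n, hu, hu0.trans hca, hbn, fun j => hbn ▸ hmax' j, ?_⟩
    rw [← hsum]
    simp only [partitionSum, consecutiveSum, hl]

end partitionSum

namespace IntervalPartition

variable {ι : Type*} [LinearOrder ι]

instance (a b : ι) : SemilatticeSup (IntervalPartition a b) :=
  Subtype.semilatticeSup fun _ _ h h' =>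
    ⟨Finset.mem_union_left _ h.1, Finset.mem_union_left _ h.2.1, fun x hx =>
      (Finset.mem_union.1 hx).elim (h.2.2 x) (h'.2.2 x)⟩

/-- The partition of `[a, b]` whose only points are the endpoints. -/
def endpoints {a b : ι} (h : a ≤ b) : IntervalPartition a b :=
  ⟨{a, b}, by simp, by simp, by simp [h]⟩

/-- The part of a partition of `[a, c]` to the left of one of its points. -/
def left {a c : ι} (π : IntervalPartition a c) {b : ι} (hb : b ∈ π.1) : IntervalPartition a b :=
  ⟨π.1.filter (· ≤ b), by simp [π.2.1, π.2.2.2 b hb], by simp [hb], fun x hx => by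
    simp only [Finset.mem_filter] at hx
    exact ⟨(π.2.2.2 x hx.1).1, hx.2⟩⟩

/-- The part of a partition of `[a, c]` to the right of one of its points. -/
def right {a c : ι} (π : IntervalPartition a c) {b : ι} (hb : b ∈ π.1) : IntervalPartition b c :=
  ⟨π.1.filter (b ≤ ·), by simp [hb], by simp [π.2.2.1, π.2.2.2 b hb], fun x hx => by
    simp only [Finset.mem_filter] at hx
    exact ⟨hx.2, (π.2.2.2 x hx.1).2⟩⟩

/-- The union of a partition of `[a, b]` and a partition of `[b, c]`. -/
def concat {a b c : ι} (π : IntervalPartition a b) (π' : IntervalPartition b c) :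
    IntervalPartition a c :=
  ⟨π.1 ∪ π'.1, Finset.mem_union_left _ π.2.1, Finset.mem_union_right _ π'.2.2.1, fun x hx => by
    have hab := (π.2.2.2 b π.2.2.1).1
    have hbc := (π'.2.2.2 b π'.2.1).2
    rcases Finset.mem_union.1 hx with h | h
    · exact ⟨(π.2.2.2 x h).1, (π.2.2.2 x h).2.trans hbc⟩
    · exact ⟨hab.trans (π'.2.2.2 x h).1, (π'.2.2.2 x h).2⟩⟩

lemma mem_concat {a b c : ι} (π : IntervalPartition a b) (π' : IntervalPartition b c) :
    b ∈ (π.concat π').1 := Finset.mem_union_left _ π.2.2.1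

lemma le_left {a b c : ι} {π : IntervalPartition a b} {π' : IntervalPartition b c}
    {ρ : IntervalPartition a c} (h : π.concat π' ≤ ρ) (hb : b ∈ ρ.1) : π ≤ ρ.left hb := by
  intro x hx
  exact Finset.mem_filter.2 ⟨h (Finset.mem_union_left _ hx), (π.2.2.2 x hx).2⟩

lemma le_right {a b c : ι} {π : IntervalPartition a b} {π' : IntervalPartition b c}
    {ρ : IntervalPartition a c} (h : π.concat π' ≤ ρ) (hb : b ∈ ρ.1) : π' ≤ ρ.right hb := by
  intro x hx
  exact Finset.mem_filter.2 ⟨h (Finset.mem_union_right _ hx), (π'.2.2.2 x hx).1⟩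

end IntervalPartition

/-! ### Sewing along the net of partitions -/

/-- The constant in the sewing estimate with exponent `θ > 1`. -/
noncomputable def sewingConst (θ : ℝ) : ℝ := 2 / (1 - 2 ^ (1 - θ))

lemma two_rpow_lt_one {θ : ℝ} (hθ : 1 < θ) : (2 : ℝ) ^ (1 - θ) < 1 :=
  Real.rpow_lt_one_of_one_lt_of_neg one_lt_two (by linarith)

lemma sewingConst_eq {θ : ℝ} (hθ : 1 < θ) :
    sewingConst θ * 2 ^ (1 - θ) + 2 = sewingConst θ := by
  have := two_rpow_lt_one hθ
  unfold sewingConst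
  field_simp [(sub_pos.2 this).ne']
  ring

lemma two_le_sewingConst {θ : ℝ} (hθ : 1 < θ) : 2 ≤ sewingConst θ := by
  have h1 := two_rpow_lt_one hθ
  have h2 : (0 : ℝ) < 2 ^ (1 - θ) := by positivity
  rw [sewingConst, le_div_iff₀ (sub_pos.2 h1)]
  linarith

section sewing

variable {ι E : Type*} [LinearOrder ι] [NormedAddCommGroup E] {ω : ι → ι → ℝ} {Ξ : ι → ι → E}

/-- A finite monotone sequence has a step that leaves at most half of the control on either
side of it. -/
lemma IsControl.exists_bisection (hω : IsControl ω) {u : ℕ → ι} (hu : Monotone u) {m n : ℕ}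
    (hmn : m < n) : ∃ i, m ≤ i ∧ i < n ∧ ω (u m) (u i) ≤ ω (u m) (u n) / 2 ∧
      ω (u (i + 1)) (u n) ≤ ω (u m) (u n) / 2 := by
  have h0 := hω.nonneg (u m) (u n)
  by_contra! hcon
  have key : ∀ i, m ≤ i → i ≤ n → ω (u m) (u i) ≤ ω (u m) (u n) / 2 := by
    intro i hi
    induction i, hi using Nat.le_induction with
    | base =>
      intro _
      rw [hω.self_eq_zero]
      linarith
    | succ i hi ih =>
      intro hin
      have h1 := hcon i hi (by omega) (ih (by omega))
      have h2 := hω.superadd _ _ _ (hu (show m ≤ i + 1 by omega)) (hu hin)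
      linarith
  have h1 := hcon (n - 1) (by omega) (by omega) (key _ (by omega) (by omega))
  rw [Nat.sub_add_cancel (by omega), hω.self_eq_zero] at h1
  linarith

/-- The sewing estimate for one finite sequence, by induction on its length: bisecting the control
gives two shorter sums with at most half of the control each. -/
lemma norm_sum_sub_le (hω : IsControl ω) {θ K : ℝ} (hθ : 1 < θ) (hK : 0 ≤ K) {u : ℕ → ι}
    (hu : Monotone u) (hΞ : ∀ i j k, i ≤ j → j ≤ k →
      ‖Ξ (u i) (u k) - Ξ (u i) (u j) - Ξ (u j) (u k)‖ ≤ K * ω (u i) (u k) ^ θ) (k : ℕ) :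
    ∀ m n, m ≤ n → n - m ≤ k → ‖∑ j ∈ Finset.Ico m n, Ξ (u j) (u (j + 1)) - Ξ (u m) (u n)‖
      ≤ sewingConst θ * K * ω (u m) (u n) ^ θ := by
  have hC := two_le_sewingConst hθ
  have base : ∀ m, ‖∑ j ∈ Finset.Ico m m, Ξ (u j) (u (j + 1)) - Ξ (u m) (u m)‖
      ≤ sewingConst θ * K * ω (u m) (u m) ^ θ := by
    intro m
    have h := hΞ m m m le_rfl le_rfl
    rw [sub_self, zero_sub, norm_neg] at h
    rw [Finset.Ico_self, Finset.sum_empty, zero_sub, norm_neg, mul_assoc]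
    refine h.trans (le_mul_of_one_le_left ?_ (by linarith))
    exact mul_nonneg hK (Real.rpow_nonneg (hω.nonneg _ _) _)
  induction k with
  | zero =>
    intro m n hmn hk
    obtain rfl : m = n := by omega
    exact base m
  | succ k ih =>
    intro m n hmn hk
    rcases hmn.eq_or_lt with rfl | hlt
    · exact base m
    obtain ⟨i, hmi, hin, hi1, hi2⟩ := hω.exists_bisection hu hlt
    have e1 := ih m i hmi (by omega)
    have e2 := ih (i + 1) n hin (by omega)
    have e3 := hΞ m i n hmi hin.le
    have e4 := hΞ i (i + 1) n (Nat.le_succ _) hin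
    set Ω := ω (u m) (u n) with hΩ
    have hΩ0 : 0 ≤ Ω := hω.nonneg _ _
    have hhalf : ∀ x, 0 ≤ x → x ≤ Ω / 2 → x ^ θ ≤ 2 ^ (1 - θ) * Ω ^ θ / 2 := by
      intro x hx hx2
      refine (Real.rpow_le_rpow hx hx2 (by linarith)).trans (le_of_eq ?_)
      rw [Real.div_rpow hΩ0 zero_le_two, Real.rpow_sub zero_lt_two, Real.rpow_one]
      field_simp
    have hCK : 0 ≤ sewingConst θ * K := mul_nonneg (by linarith) hK
    have f1 := e1.trans (mul_le_mul_of_nonneg_left (hhalf _ (hω.nonneg _ _) hi1) hCK)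
    have f2 := e2.trans (mul_le_mul_of_nonneg_left (hhalf _ (hω.nonneg _ _) hi2) hCK)
    have f4 := e4.trans (mul_le_mul_of_nonneg_left (Real.rpow_le_rpow (hω.nonneg _ _)
      (hω.mono (hu hmi) (hu hin.le) le_rfl) (by linarith : (0 : ℝ) ≤ θ)) hK)
    have hsum : ∑ j ∈ Finset.Ico m n, Ξ (u j) (u (j + 1)) - Ξ (u m) (u n)
        = (∑ j ∈ Finset.Ico m i, Ξ (u j) (u (j + 1)) - Ξ (u m) (u i))
          + (∑ j ∈ Finset.Ico (i + 1) n, Ξ (u j) (u (j + 1)) - Ξ (u (i + 1)) (u n))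
          - (Ξ (u m) (u n) - Ξ (u m) (u i) - Ξ (u i) (u n))
          - (Ξ (u i) (u n) - Ξ (u i) (u (i + 1)) - Ξ (u (i + 1)) (u n)) := by
      rw [← Finset.sum_Ico_consecutive _ hmi hin.le, Finset.sum_eq_sum_Ico_succ_bot hin]
      abel
    rw [hsum]
    calc _ ≤ sewingConst θ * K * (2 ^ (1 - θ) * Ω ^ θ / 2)
          + sewingConst θ * K * (2 ^ (1 - θ) * Ω ^ θ / 2) + K * Ω ^ θ + K * Ω ^ θ := by
          refine (norm_sub_le _ _).trans (add_le_add ((norm_sub_le _ _).trans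
            (add_le_add ((norm_add_le _ _).trans (add_le_add f1 f2)) e3)) f4)
      _ = (sewingConst θ * 2 ^ (1 - θ) + 2) * K * Ω ^ θ := by ring
      _ = _ := by rw [sewingConst_eq hθ]

lemma norm_partitionSum_sub_le (hω : IsControl ω) {θ K : ℝ} (hθ : 1 < θ) (hK : 0 ≤ K) {a b : ι}
    (hΞ : ∀ s t u, a ≤ s → s ≤ t → t ≤ u → u ≤ b →
      ‖Ξ s u - Ξ s t - Ξ t u‖ ≤ K * ω s u ^ θ) (π : IntervalPartition a b) :
    ‖partitionSum Ξ π.1 - Ξ a b‖ ≤ sewingConst θ * K * ω a b ^ θ := by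
  obtain ⟨u, n, hu, hu0, hun, hle, hsum⟩ := exists_monotone_partitionSum Ξ π
  have := norm_sum_sub_le hω hθ hK hu (fun i j k hij hjk =>
    hΞ _ _ _ (hu0 ▸ hu (Nat.zero_le _)) (hu hij) (hu hjk) (hle _)) n 0 n (Nat.zero_le _)
    (by simp)
  rwa [hu0, hun, ← Finset.range_eq_Ico, ← hsum] at this

/-- The Cauchy property of the partition sums. Cutting `[a, b]` at points that have control at
least `η` on both sides stops after finitely many steps. On each interval that remains, of any two
adjacent intervals one has control at most `η`, and the sewing estimate there has a small
constant. -/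
lemma exists_partition_norm_sub_le (hω : IsControl ω) {σ θ K : ℝ} (hσ : 0 < σ) (hθ : 1 < θ)
    (hK : 0 ≤ K) (hΞ : ∀ s t u, s ≤ t → t ≤ u →
      ‖Ξ s u - Ξ s t - Ξ t u‖ ≤ K * min (ω s t) (ω t u) ^ σ * ω s u ^ θ)
    {ε Ω : ℝ} (hε : 0 < ε) (hΩ : 0 ≤ Ω) (a b : ι) (hab : a ≤ b) (habΩ : ω a b ≤ Ω) :
    ∃ (v : E) (π₀ : IntervalPartition a b), ∀ π ≥ π₀, ‖partitionSum Ξ π.1 - v‖ ≤ ε * ω a b := by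
  have hC := two_le_sewingConst hθ
  set D := sewingConst θ * K * Ω ^ (θ - 1) with hD
  have hD0 : 0 ≤ D := by positivity
  set η : ℝ := (ε / (D + 1)) ^ (1 / σ) with hη
  have hη0 : 0 < η := by positivity
  have hησ : D * η ^ σ ≤ ε := by
    rw [hη, ← Real.rpow_mul (by positivity), one_div_mul_cancel hσ.ne', Real.rpow_one,
      mul_div_assoc', div_le_iff₀ (by positivity)]
    nlinarith
  obtain ⟨N, hN⟩ := exists_nat_ge (ω a b / η)
  rw [div_le_iff₀ hη0] at hN
  induction N generalizing a b with
  | zero =>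
    have hz : ω a b = 0 := le_antisymm (by simpa using hN) (hω.nonneg _ _)
    have hsmall : ∀ s t u, a ≤ s → s ≤ t → t ≤ u → u ≤ b →
        ‖Ξ s u - Ξ s t - Ξ t u‖ ≤ 0 * ω s u ^ θ := by
      intro s t u h1 h2 h3 h4
      have h5 : ω s u = 0 :=
        le_antisymm (hz ▸ hω.mono h1 (h2.trans h3) h4) (hω.nonneg _ _)
      have := hΞ s t u h2 h3
      rwa [h5, Real.zero_rpow (by linarith), mul_zero] at this ⊢
    refine ⟨Ξ a b, IntervalPartition.endpoints hab, fun π _ => ?_⟩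
    have h1 := norm_partitionSum_sub_le hω hθ le_rfl hsmall π
    rw [mul_zero, zero_mul] at h1
    rwa [hz, mul_zero]
  | succ N ih =>
    by_cases hgood : ∀ s t u, a ≤ s → s ≤ t → t ≤ u → u ≤ b → min (ω s t) (ω t u) ≤ η
    · have hsmall : ∀ s t u, a ≤ s → s ≤ t → t ≤ u → u ≤ b →
          ‖Ξ s u - Ξ s t - Ξ t u‖ ≤ K * η ^ σ * ω s u ^ θ := by
        intro s t u h1 h2 h3 h4
        refine (hΞ s t u h2 h3).trans (mul_le_mul_of_nonneg_right (mul_le_mul_of_nonneg_left ?_ hK)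
          (Real.rpow_nonneg (hω.nonneg _ _) _))
        exact Real.rpow_le_rpow (le_min (hω.nonneg _ _) (hω.nonneg _ _)) (hgood s t u h1 h2 h3 h4)
          hσ.le
      have hKη : 0 ≤ K * η ^ σ := by positivity
      refine ⟨Ξ a b, IntervalPartition.endpoints hab, fun π _ => ?_⟩
      have h1 := norm_partitionSum_sub_le hω hθ hKη hsmall π
      have h3 : ω a b ^ θ ≤ Ω ^ (θ - 1) * ω a b := by
        rcases (hω.nonneg a b).eq_or_lt with h0 | h0
        · rw [← h0, Real.zero_rpow (by linarith), mul_zero]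
        · calc ω a b ^ θ = ω a b ^ (θ - 1) * ω a b := by
                rw [← Real.rpow_add_one h0.ne']
                congr 1
                ring
            _ ≤ _ := mul_le_mul_of_nonneg_right
                (Real.rpow_le_rpow h0.le habΩ (by linarith)) h0.le
      have h4 : sewingConst θ * (K * η ^ σ) * ω a b ^ θ
          ≤ sewingConst θ * (K * η ^ σ) * (Ω ^ (θ - 1) * ω a b) :=
        mul_le_mul_of_nonneg_left h3 (by positivity)
      calc _ ≤ D * η ^ σ * ω a b := by
            rw [hD]
            linarith
        _ ≤ _ := mul_le_mul_of_nonneg_right hησ (hω.nonneg _ _)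
    · push Not at hgood
      obtain ⟨s, t, u, has, hst, htu, hub, hmin⟩ := hgood
      have hat := has.trans hst
      have htb := htu.trans hub
      have h1 : η ≤ ω a t := ((lt_min_iff.1 hmin).1.le).trans (hω.mono has hst le_rfl)
      have h2 : η ≤ ω t b := ((lt_min_iff.1 hmin).2.le).trans (hω.mono le_rfl htu hub)
      have h3 := hω.superadd a t b hat htb
      push_cast at hN
      obtain ⟨v₁, π₁, hπ₁⟩ := ih a t hat (by linarith) (by linarith)
      obtain ⟨v₂, π₂, hπ₂⟩ := ih t b htb (by linarith) (by linarith)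
      refine ⟨v₁ + v₂, π₁.concat π₂, fun π hπ => ?_⟩
      have ht : t ∈ π.1 := hπ (IntervalPartition.mem_concat _ _)
      have e₁ := hπ₁ (π.left ht) (IntervalPartition.le_left hπ ht)
      have e₂ := hπ₂ (π.right ht) (IntervalPartition.le_right hπ ht)
      rw [partitionSum_split Ξ ht, add_sub_add_comm]
      refine (norm_add_le _ _).trans ((add_le_add e₁ e₂).trans ?_)
      rw [← mul_add]
      exact mul_le_mul_of_nonneg_left h3 hε.le

lemma cauchySeq_partitionSum (hω : IsControl ω) {σ θ K : ℝ} (hσ : 0 < σ) (hθ : 1 < θ)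
    (hK : 0 ≤ K) (hΞ : ∀ s t u, s ≤ t → t ≤ u →
      ‖Ξ s u - Ξ s t - Ξ t u‖ ≤ K * min (ω s t) (ω t u) ^ σ * ω s u ^ θ)
    {a b : ι} (hab : a ≤ b) :
    CauchySeq (fun π : IntervalPartition a b => partitionSum Ξ π.1) := by
  have : Nonempty (IntervalPartition a b) := ⟨IntervalPartition.endpoints hab⟩
  have hω0 := hω.nonneg a b
  refine Metric.cauchySeq_iff.2 fun ε hε => ?_
  obtain ⟨v, π₀, h⟩ := exists_partition_norm_sub_le hω hσ hθ hK hΞ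
    (show 0 < ε / 3 / (ω a b + 1) by positivity) hω0 a b hab le_rfl
  have hlt : ε / 3 / (ω a b + 1) * ω a b ≤ ε / 3 := by
    rw [div_mul_eq_mul_div, div_le_iff₀ (by positivity)]
    nlinarith
  refine ⟨π₀, fun π hπ π' hπ' => ?_⟩
  have h1 := h π hπ
  have h2 := h π' hπ'
  rw [← dist_eq_norm] at h1 h2
  have := dist_triangle_right (partitionSum Ξ π.1) (partitionSum Ξ π'.1) v
  linarith

/-- Sewing: an almost additive `Ξ` has an additive limit `I` along the partitions directed by
inclusion, with a quantitative bound for `I - Ξ`. The factor `min (ω s t) (ω t u) ^ σ` replaces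
the continuity of the control. -/
theorem exists_sewing [CompleteSpace E] (hω : IsControl ω) {σ θ K : ℝ} (hσ : 0 < σ) (hθ : 1 < θ)
    (hK : 0 ≤ K) (hΞ : ∀ s t u, s ≤ t → t ≤ u →
      ‖Ξ s u - Ξ s t - Ξ t u‖ ≤ K * min (ω s t) (ω t u) ^ σ * ω s u ^ θ) :
    ∃ I : ι → ι → E,
      (∀ a b, a ≤ b →
        Tendsto (fun π : IntervalPartition a b => partitionSum Ξ π.1) atTop (𝓝 (I a b))) ∧
      (∀ a b c, a ≤ b → b ≤ c → I a c = I a b + I b c) ∧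
      ∀ a b, a ≤ b → ‖I a b - Ξ a b‖ ≤ sewingConst (σ + θ) * K * ω a b ^ (σ + θ) := by
  classical
  have hex : ∀ a b : ι, ∃ v : E, a ≤ b →
      Tendsto (fun π : IntervalPartition a b => partitionSum Ξ π.1) atTop (𝓝 v) := by
    intro a b
    by_cases hab : a ≤ b
    · obtain ⟨v, hv⟩ := cauchySeq_tendsto_of_complete
        (cauchySeq_partitionSum hω hσ hθ hK hΞ hab)
      exact ⟨v, fun _ => hv⟩
    · exact ⟨0, fun h => absurd h hab⟩
  choose I hI using hex
  refine ⟨I, hI, fun a b c hab hbc => ?_, fun a b hab => ?_⟩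
  · have : Nonempty (IntervalPartition a b) := ⟨IntervalPartition.endpoints hab⟩
    have : Nonempty (IntervalPartition b c) := ⟨IntervalPartition.endpoints hbc⟩
    have : Nonempty (IntervalPartition a c) := ⟨IntervalPartition.endpoints (hab.trans hbc)⟩
    refine eq_of_forall_dist_le fun ε hε => ?_
    obtain ⟨π₁, h₁⟩ := (Metric.tendsto_atTop.1 (hI a b hab)) (ε / 3) (by positivity)
    obtain ⟨π₂, h₂⟩ := (Metric.tendsto_atTop.1 (hI b c hbc)) (ε / 3) (by positivity)
    obtain ⟨π₃, h₃⟩ := (Metric.tendsto_atTop.1 (hI a c (hab.trans hbc))) (ε / 3) (by positivity)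
    set π := π₃ ⊔ π₁.concat π₂
    have hle : π₁.concat π₂ ≤ π := le_sup_right
    have hb : b ∈ π.1 := hle (IntervalPartition.mem_concat _ _)
    have e₁ := h₁ (π.left hb) (IntervalPartition.le_left hle hb)
    have e₂ := h₂ (π.right hb) (IntervalPartition.le_right hle hb)
    have e₃ := h₃ π le_sup_left
    rw [partitionSum_split Ξ hb] at e₃
    have e₄ := (dist_add_add_le _ _ _ _).trans (add_le_add e₁.le e₂.le)
    have e₅ := dist_triangle_left (I a c) (I a b + I b c) _ |>.trans (add_le_add e₃.le e₄)
    linarith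
  · have : Nonempty (IntervalPartition a b) := ⟨IntervalPartition.endpoints hab⟩
    refine le_of_tendsto ((hI a b hab).sub_const (Ξ a b)).norm (Eventually.of_forall fun π => ?_)
    refine norm_partitionSum_sub_le hω (by linarith) hK (fun s t u _ hst htu _ => ?_) π
    refine (hΞ s t u hst htu).trans ?_
    rw [Real.rpow_add_of_nonneg (hω.nonneg _ _) hσ.le (by linarith), ← mul_assoc]
    refine mul_le_mul_of_nonneg_right (mul_le_mul_of_nonneg_left ?_ hK)
      (Real.rpow_nonneg (hω.nonneg _ _) _)
    exact Real.rpow_le_rpow (le_min (hω.nonneg _ _) (hω.nonneg _ _))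
      ((min_le_left _ _).trans (hω.mono le_rfl hst htu)) hσ.le

/-- Sewing for products of three increments of a control with exponents `1 / r`, where `r < 3`. -/
theorem exists_sewing_of_cubic [CompleteSpace E] (hω : IsControl ω) {r K : ℝ} (hr₂ : 2 ≤ r)
    (hr₃ : r < 3) (hK : 0 ≤ K) (hΞ : ∀ s t u, s ≤ t → t ≤ u →
      ‖Ξ s u - Ξ s t - Ξ t u‖
        ≤ K * (ω s t ^ (1 / r) * ω t u ^ (1 / r) * ω s u ^ (1 / r))) :
    ∃ I : ι → ι → E,
      (∀ a b, a ≤ b →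
        Tendsto (fun π : IntervalPartition a b => partitionSum Ξ π.1) atTop (𝓝 (I a b))) ∧
      (∀ a b c, a ≤ b → b ≤ c → I a c = I a b + I b c) ∧
      ∀ a b, a ≤ b → ‖I a b - Ξ a b‖ ≤ sewingConst (3 / r) * K * (ω a b ^ (1 / r)) ^ 3 := by
  have hr0 : 0 < r := by linarith
  have h3r : 1 < 3 / r := by rwa [lt_div_iff₀ hr0, one_mul]
  have h1r : 0 < 1 / r := by positivity
  have h13 : 3 / r = 3 * (1 / r) := by ring
  have h12 : 1 / r ≤ 1 / 2 := one_div_le_one_div_of_le two_pos hr₂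
  obtain ⟨I, h1, h2, h3⟩ := exists_sewing (Ξ := Ξ) (σ := (3 / r - 1) / 2) (θ := (3 / r + 1) / 2)
    hω (by linarith) (by linarith) hK (fun s t u hst htu => by
      refine (hΞ s t u hst htu).trans ?_
      rw [mul_assoc K (min _ _ ^ _)]
      refine mul_le_mul_of_nonneg_left ?_ hK
      set x := ω s t
      set y := ω t u
      set z := ω s u
      have hx : 0 ≤ x := hω.nonneg _ _
      have hy : 0 ≤ y := hω.nonneg _ _
      have hz : 0 ≤ z := hω.nonneg _ _
      have hxz : x ≤ z := hω.mono le_rfl hst htu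
      have hyz : y ≤ z := hω.mono hst htu le_rfl
      have hm : 0 ≤ min x y := le_min hx hy
      calc x ^ (1 / r) * y ^ (1 / r) * z ^ (1 / r)
          ≤ (min x y ^ (1 / r) * z ^ (1 / r)) * z ^ (1 / r) := by
            refine mul_le_mul_of_nonneg_right ?_ (Real.rpow_nonneg hz _)
            rcases le_total x y with h | h
            · rw [min_eq_left h]
              exact mul_le_mul_of_nonneg_left (Real.rpow_le_rpow hy hyz h1r.le)
                (Real.rpow_nonneg hx _)
            · rw [min_eq_right h, mul_comm]
              exact mul_le_mul_of_nonneg_left (Real.rpow_le_rpow hx hxz h1r.le)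
                (Real.rpow_nonneg hy _)
        _ = min x y ^ ((3 / r - 1) / 2) * (min x y ^ (1 / r - (3 / r - 1) / 2)
              * z ^ (1 / r) * z ^ (1 / r)) := by
            rw [← mul_assoc, ← mul_assoc, ← Real.rpow_add_of_nonneg hm (by linarith)
              (by linarith), add_sub_cancel]
        _ ≤ min x y ^ ((3 / r - 1) / 2) * (z ^ (1 / r - (3 / r - 1) / 2)
              * z ^ (1 / r) * z ^ (1 / r)) := by
            have := Real.rpow_le_rpow hm ((min_le_left x y).trans hxz)
              (show 0 ≤ 1 / r - (3 / r - 1) / 2 by linarith)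
            gcongr
        _ = _ := by
            rw [← Real.rpow_add_of_nonneg hz (by linarith) h1r.le,
              ← Real.rpow_add_of_nonneg hz (by linarith) h1r.le]
            congr 2
            linarith)
  refine ⟨I, h1, h2, fun a b hab => (h3 a b hab).trans (le_of_eq ?_)⟩
  rw [← Real.rpow_natCast, ← Real.rpow_mul (hω.nonneg _ _),
    show (3 / r - 1) / 2 + (3 / r + 1) / 2 = 3 / r by ring]
  congr 2
  push_cast
  ring

end sewing

/-! ### Taylor estimates for functions of class `C^{2,1}_b` -/

/-- `M ≥ 1` is a common bound for `φ`, `Dφ`, `D²φ` and the Lipschitz constant of `D²φ`. Of `D²φ`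
only the resulting bounds for the increments of `Dφ` are recorded, namely the Lipschitz bound and
the bound for the difference of two parallel increments. -/
structure C21Bound {E F : Type*} [NormedAddCommGroup E] [NormedSpace ℝ E]
    [NormedAddCommGroup F] [NormedSpace ℝ F] (φ : E → F) (M : ℝ) : Prop where
  one_le : 1 ≤ M
  differentiable : Differentiable ℝ φ
  norm_le : ∀ x, ‖φ x‖ ≤ M
  norm_fderiv_le : ∀ x, ‖fderiv ℝ φ x‖ ≤ M
  lipschitz_fderiv : ∀ x y, ‖fderiv ℝ φ x - fderiv ℝ φ y‖ ≤ M * ‖x - y‖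
  parallel_fderiv : ∀ y y' h, ‖(fderiv ℝ φ (y + h) - fderiv ℝ φ y)
    - (fderiv ℝ φ (y' + h) - fderiv ℝ φ y')‖ ≤ M * ‖h‖ * ‖y - y'‖

section C21

variable {E F : Type*} [NormedAddCommGroup E] [NormedSpace ℝ E]
  [NormedAddCommGroup F] [NormedSpace ℝ F]

lemma norm_sub_le_of_norm_fderiv_le {f : E → F} (hf : Differentiable ℝ f) {M : ℝ}
    (hM : ∀ x, ‖fderiv ℝ f x‖ ≤ M) (x y : E) : ‖f x - f y‖ ≤ M * ‖x - y‖ :=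
  convex_univ.norm_image_sub_le_of_norm_fderiv_le (fun z _ => hf z) (fun z _ => hM z)
    (mem_univ y) (mem_univ x)

lemma norm_parallel_sub_le {f : E → F} (hf : Differentiable ℝ f) {L : ℝ}
    (hL : ∀ x y, ‖fderiv ℝ f x - fderiv ℝ f y‖ ≤ L * ‖x - y‖) (y y' h : E) :
    ‖(f (y + h) - f y) - (f (y' + h) - f y')‖ ≤ L * ‖h‖ * ‖y - y'‖ := by
  have hd : ∀ z, HasFDerivAt (fun z => f (z + h) - f z)
      (fderiv ℝ f (z + h) - fderiv ℝ f z) z := fun z =>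
    ((hasFDerivAt_comp_add_right h).2 (hf (z + h)).hasFDerivAt).sub (hf z).hasFDerivAt
  refine norm_sub_le_of_norm_fderiv_le (fun z => (hd z).differentiableAt) (fun z => ?_) y y'
  rw [(hd z).fderiv]
  simpa using hL (z + h) z

lemma IsC21b.exists_bound {φ : E → F} (hφ : IsC21b φ) : ∃ M, C21Bound φ M := by
  obtain ⟨C₀, h₀⟩ := hφ.bounded
  obtain ⟨C₁, h₁⟩ := hφ.bounded_fderiv
  obtain ⟨C₂, h₂⟩ := hφ.bounded_fderiv₂
  obtain ⟨K, hK⟩ := hφ.lipschitz_fderiv₂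
  set M : ℝ := max (max 1 C₀) (max (max C₁ C₂) K)
  have m₁ : (1 : ℝ) ≤ M := (le_max_left _ _).trans (le_max_left _ _)
  have m₀ : C₀ ≤ M := (le_max_right _ _).trans (le_max_left _ _)
  have m₂ : C₁ ≤ M := (le_max_left _ _).trans ((le_max_left _ _).trans (le_max_right _ _))
  have m₃ : C₂ ≤ M := (le_max_right _ _).trans ((le_max_left _ _).trans (le_max_right _ _))
  have m₄ : (K : ℝ) ≤ M := (le_max_right _ _).trans (le_max_right _ _)
  exact ⟨M, m₁, hφ.differentiable, fun x => (h₀ x).trans m₀, fun x => (h₁ x).trans m₂,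
    norm_sub_le_of_norm_fderiv_le hφ.differentiable_fderiv fun x => (h₂ x).trans m₃,
    norm_parallel_sub_le hφ.differentiable_fderiv fun x y =>
      (hK.norm_sub_le x y).trans (mul_le_mul_of_nonneg_right m₄ (norm_nonneg _))⟩

namespace C21Bound

variable {φ : E → F} {M : ℝ}

lemma lipschitz (hφ : C21Bound φ M) (x y : E) : ‖φ x - φ y‖ ≤ M * ‖x - y‖ :=
  norm_sub_le_of_norm_fderiv_le hφ.differentiable hφ.norm_fderiv_le x y

lemma increments_sub (hφ : C21Bound φ M) (y y' z z' : E) :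
    ‖(φ z - φ y) - (φ z' - φ y')‖ ≤ M * ‖(z - y) - (z' - y')‖ + M * ‖z' - y'‖ * ‖y - y'‖ := by
  have h1 := hφ.lipschitz z (y + (z' - y'))
  have h2 := norm_parallel_sub_le hφ.differentiable hφ.lipschitz_fderiv y y' (z' - y')
  rw [show z - (y + (z' - y')) = (z - y) - (z' - y') by abel] at h1
  rw [add_sub_cancel y' z'] at h2
  refine le_trans (le_of_eq ?_) ((norm_add_le _ _).trans (add_le_add h1 h2))
  congr 1
  abel

lemma increments_fderiv_sub (hφ : C21Bound φ M) (y y' z z' : E) :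
    ‖(fderiv ℝ φ z - fderiv ℝ φ y) - (fderiv ℝ φ z' - fderiv ℝ φ y')‖
      ≤ M * ‖(z - y) - (z' - y')‖ + M * ‖z' - y'‖ * ‖y - y'‖ := by
  have h1 := hφ.lipschitz_fderiv z (y + (z' - y'))
  have h2 := hφ.parallel_fderiv y y' (z' - y')
  rw [show z - (y + (z' - y')) = (z - y) - (z' - y') by abel] at h1
  rw [add_sub_cancel y' z'] at h2
  refine le_trans (le_of_eq ?_) ((norm_add_le _ _).trans (add_le_add h1 h2))
  congr 1
  abel

lemma taylor_sub_same_base (hφ : C21Bound φ M) (y h h' : E) :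
    ‖(φ (y + h) - fderiv ℝ φ y h) - (φ (y + h') - fderiv ℝ φ y h')‖
      ≤ M * (‖h‖ + ‖h'‖) * ‖h - h'‖ := by
  have hd : ∀ x, HasFDerivAt (fun x => φ (y + x) - fderiv ℝ φ y x)
      (fderiv ℝ φ (y + x) - fderiv ℝ φ y) x := fun x =>
    ((hasFDerivAt_comp_add_left y).2 (hφ.differentiable (y + x)).hasFDerivAt).sub (fderiv ℝ φ y).hasFDerivAt
  refine (convex_closedBall (0 : E) (‖h‖ + ‖h'‖)).norm_image_sub_le_of_norm_fderiv_le
    (fun x _ => (hd x).differentiableAt) (fun x hx => ?_) (by simp) (by simp)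
  rw [(hd x).fderiv]
  refine (hφ.lipschitz_fderiv _ _).trans ?_
  rw [add_sub_cancel_left]
  exact mul_le_mul_of_nonneg_left (by simpa using hx) (by linarith [hφ.one_le])

lemma taylor (hφ : C21Bound φ M) (y z : E) :
    ‖φ z - φ y - fderiv ℝ φ y (z - y)‖ ≤ M * ‖z - y‖ ^ 2 := by
  have h := hφ.taylor_sub_same_base y (z - y) 0
  simp only [add_sub_cancel, add_zero, map_zero, sub_zero, norm_zero] at h
  refine le_trans (le_of_eq ?_) (h.trans (le_of_eq ?_))
  · congr 1
    abel
  · ring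

/-- The difference of two second order Taylor remainders. To compare the base points, the remainder
is differentiated in the increment; this needs no symmetry of `D²φ`. -/
lemma taylor_sub (hφ : C21Bound φ M) (y y' z z' : E) :
    ‖(φ z - φ y - fderiv ℝ φ y (z - y)) - (φ z' - φ y' - fderiv ℝ φ y' (z' - y'))‖
      ≤ M * (‖z - y‖ + ‖z' - y'‖) * ‖(z - y) - (z' - y')‖ + M * ‖z' - y'‖ ^ 2 * ‖y - y'‖ := by
  have hM := hφ.one_le
  have h1 := hφ.taylor_sub_same_base y (z - y) (z' - y')
  set h' := z' - y' with hh'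
  have hd : ∀ x, HasFDerivAt
      (fun x => (φ (y + x) - fderiv ℝ φ y x) - (φ (y' + x) - fderiv ℝ φ y' x))
      ((fderiv ℝ φ (y + x) - fderiv ℝ φ y) - (fderiv ℝ φ (y' + x) - fderiv ℝ φ y')) x := fun x =>
    (((hasFDerivAt_comp_add_left y).2 (hφ.differentiable (y + x)).hasFDerivAt).sub
      (fderiv ℝ φ y).hasFDerivAt).sub
      (((hasFDerivAt_comp_add_left y').2 (hφ.differentiable (y' + x)).hasFDerivAt).sub
        (fderiv ℝ φ y').hasFDerivAt)
  have h2 := (convex_closedBall (0 : E) ‖h'‖).norm_image_sub_le_of_norm_fderiv_le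
    (C := M * ‖h'‖ * ‖y - y'‖) (x := 0) (y := h')
    (fun x _ => (hd x).differentiableAt) (fun x hx => by
      rw [(hd x).fderiv]
      refine (hφ.parallel_fderiv _ _ _).trans ?_
      have : ‖x‖ ≤ ‖h'‖ := by simpa using hx
      gcongr) (by simp) (by simp)
  simp only [add_zero, map_zero, sub_zero] at h2
  have hz' : y' + h' = z' := add_sub_cancel y' z'
  rw [hz'] at h2
  rw [add_sub_cancel y z] at h1
  refine le_trans (le_of_eq ?_) ((norm_add_le _ _).trans
    (add_le_add h1 (h2.trans (le_of_eq (by ring)))))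
  congr 1
  abel

end C21Bound

end C21

/-! ### The action on the tensor product -/

section tensorApply

variable {d : ℕ} {F : Type*} [NormedAddCommGroup F] [NormedSpace ℝ F]

lemma tensorApply_add (L : EuclideanSpace ℝ (Fin d) →L[ℝ] (EuclideanSpace ℝ (Fin d) →L[ℝ] F))
    (x y : EuclideanSpace ℝ (Fin d × Fin d)) :
    tensorApply L (x + y) = tensorApply L x + tensorApply L y := by
  simp only [tensorApply, PiLp.add_apply, add_smul, Finset.sum_add_distrib]

lemma tensorApply_sub_left
    (L L' : EuclideanSpace ℝ (Fin d) →L[ℝ] (EuclideanSpace ℝ (Fin d) →L[ℝ] F))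
    (x : EuclideanSpace ℝ (Fin d × Fin d)) :
    tensorApply (L - L') x = tensorApply L x - tensorApply L' x := by
  simp only [tensorApply, sub_apply, smul_sub, Finset.sum_sub_distrib]

lemma tensorApply_outer
    (L : EuclideanSpace ℝ (Fin d) →L[ℝ] (EuclideanSpace ℝ (Fin d) →L[ℝ] F))
    (a b : EuclideanSpace ℝ (Fin d)) : tensorApply L (outer a b) = L a b := by
  have hsum : ∀ x : EuclideanSpace ℝ (Fin d), x = ∑ i, x i • EuclideanSpace.single i (1 : ℝ) :=
    fun x => by simpa using ((EuclideanSpace.basisFun (Fin d) ℝ).sum_repr x).symm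
  conv_rhs => rw [hsum a, hsum b]
  simp only [tensorApply, outer, map_sum, map_smul, sum_apply,
    smul_apply, Finset.smul_sum, mul_smul]
  rw [Finset.sum_comm]
  exact Finset.sum_congr rfl fun i _ => Finset.sum_congr rfl fun j _ => smul_comm _ _ _

lemma norm_tensorApply_le
    (L : EuclideanSpace ℝ (Fin d) →L[ℝ] (EuclideanSpace ℝ (Fin d) →L[ℝ] F))
    (x : EuclideanSpace ℝ (Fin d × Fin d)) : ‖tensorApply L x‖ ≤ (d : ℝ) ^ 2 * ‖L‖ * ‖x‖ := by
  have hentry : ∀ i j, ‖x (i, j) • L (EuclideanSpace.single i 1) (EuclideanSpace.single j 1)‖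
      ≤ ‖L‖ * ‖x‖ := by
    intro i j
    rw [norm_smul, mul_comm]
    have h1 := (L (EuclideanSpace.single i 1)).le_opNorm (EuclideanSpace.single j 1)
    have h2 := L.le_opNorm (EuclideanSpace.single i 1)
    simp only [PiLp.norm_single, norm_one, mul_one] at h1 h2
    exact mul_le_mul (h1.trans h2) (PiLp.norm_apply_le x (i, j)) (norm_nonneg _) (norm_nonneg L)
  refine (norm_sum_le _ _).trans ((Finset.sum_le_sum fun i _ => (norm_sum_le _ _).trans
    (Finset.sum_le_sum fun j _ => hentry i j)).trans (le_of_eq ?_))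
  simp only [Finset.sum_const, Finset.card_univ, Fintype.card_fin, nsmul_eq_mul]
  ring

end tensorApply

/-! ### Rough integrals of controlled paths -/

/-- `ω` is a control that dominates the rough path `X`: `‖X_{s,t}‖ ≤ ω(s,t)^{1/r}` and
`‖𝕏_{s,t}‖ ≤ ω(s,t)^{2/r}`. -/
structure RoughPath.DominatedBy {r T : ℝ} {d : ℕ} (X : RoughPath r T d)
    (ω : Icc (0 : ℝ) T → Icc (0 : ℝ) T → ℝ) : Prop where
  isControl : IsControl ω
  norm_path_le : ∀ s t, s ≤ t → ‖X.path t - X.path s‖ ≤ ω s t ^ (1 / r)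
  norm_area_le : ∀ s t, s ≤ t → ‖X.area s t‖ ≤ (ω s t ^ (1 / r)) ^ 2

/-- The summand `Z_s X_{s,t} + Z'_s 𝕏_{s,t}` of the compensated Riemann sums. -/
noncomputable def roughGerm {r T : ℝ} {d : ℕ} {F : Type*} [NormedAddCommGroup F] [NormedSpace ℝ F]
    (X : RoughPath r T d) (Z : Icc (0 : ℝ) T → (EuclideanSpace ℝ (Fin d) →L[ℝ] F))
    (Z' : Icc (0 : ℝ) T →
      (EuclideanSpace ℝ (Fin d) →L[ℝ] (EuclideanSpace ℝ (Fin d) →L[ℝ] F)))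
    (s t : Icc (0 : ℝ) T) : F :=
  Z s (X.path t - X.path s) + tensorApply (Z' s) (X.area s t)

lemma partitionSum_sub {ι E : Type*} [LinearOrder ι] [AddCommGroup E] (Ξ Ξ' : ι → ι → E)
    (π : Finset ι) :
    partitionSum (fun s t => Ξ s t - Ξ' s t) π = partitionSum Ξ π - partitionSum Ξ' π := by
  have key : ∀ l : List ι, consecutiveSum (fun s t => Ξ s t - Ξ' s t) l
      = consecutiveSum Ξ l - consecutiveSum Ξ' l := by
    intro l
    induction l with
    | nil => simp [consecutiveSum]
    | cons a l ih =>
      cases l with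
      | nil => simp [consecutiveSum]
      | cons b l =>
        simp only [consecutiveSum, List.tail_cons, List.zipWith_cons_cons, List.sum_cons] at ih ⊢
        rw [ih]
        abel
  exact key _

section roughIntegral

variable {r T : ℝ} {d : ℕ} {X : RoughPath r T d} {ω : Icc (0 : ℝ) T → Icc (0 : ℝ) T → ℝ}

namespace RoughPath.DominatedBy

lemma rpow_nonneg (h : X.DominatedBy ω) (s t) : 0 ≤ ω s t ^ (1 / r) :=
  Real.rpow_nonneg (h.isControl.nonneg s t) _

lemma rpow_mono (h : X.DominatedBy ω) (hr : 0 ≤ r) {s s' t' t : Icc (0 : ℝ) T} (h1 : s ≤ s')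
    (h2 : s' ≤ t') (h3 : t' ≤ t) : ω s' t' ^ (1 / r) ≤ ω s t ^ (1 / r) :=
  Real.rpow_le_rpow (h.isControl.nonneg _ _) (h.isControl.mono h1 h2 h3) (one_div_nonneg.2 hr)

lemma area_self (h : X.DominatedBy ω) (hr : 0 < r) (s) : X.area s s = 0 := by
  have := h.norm_area_le s s le_rfl
  rw [h.isControl.self_eq_zero, Real.zero_rpow (one_div_pos.2 hr).ne'] at this
  simpa using this

/-- Chen's relation on the closed simplex. -/
lemma chen_of_le (h : X.DominatedBy ω) (hr : 0 < r) {s t u : Icc (0 : ℝ) T} (hst : s ≤ t)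
    (htu : t ≤ u) : X.area s u
      = X.area s t + X.area t u + outer (X.path t - X.path s) (X.path u - X.path t) := by
  rcases hst.eq_or_lt with rfl | hst
  · have : outer (0 : EuclideanSpace ℝ (Fin d)) (X.path u - X.path s) = 0 := by
      ext k
      simp [outer]
    rw [h.area_self hr, sub_self, this, zero_add, add_zero]
  rcases htu.eq_or_lt with rfl | htu
  · have : outer (X.path t - X.path s) (0 : EuclideanSpace ℝ (Fin d)) = 0 := by
      ext k
      simp [outer]
    rw [h.area_self hr, sub_self, this, add_zero, add_zero]
  exact X.chen s t u hst htu

end RoughPath.DominatedBy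

variable {F : Type*} [NormedAddCommGroup F] [NormedSpace ℝ F]
  {Z W : Icc (0 : ℝ) T → (EuclideanSpace ℝ (Fin d) →L[ℝ] F)}
  {Z' W' : Icc (0 : ℝ) T → (EuclideanSpace ℝ (Fin d) →L[ℝ] (EuclideanSpace ℝ (Fin d) →L[ℝ] F))}

/-- Chen's relation turns the defect of additivity of the germ into products of increments. -/
lemma roughGerm_sub_sub (h : X.DominatedBy ω) (hr : 0 < r) {s t u : Icc (0 : ℝ) T} (hst : s ≤ t)
    (htu : t ≤ u) : roughGerm X Z Z' s u - roughGerm X Z Z' s t - roughGerm X Z Z' t u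
      = -(remainder X Z Z' s t (X.path u - X.path t) + tensorApply (Z' t - Z' s) (X.area t u)) := by
  simp only [roughGerm, remainder, h.chen_of_le hr hst htu, tensorApply_add, tensorApply_outer,
    tensorApply_sub_left, map_sub, sub_apply]
  abel

lemma norm_roughGerm_sub_sub_le (h : X.DominatedBy ω) (hr : 0 < r) {K : ℝ} (hK : 0 ≤ K)
    (hR : ∀ s t, s ≤ t → ‖remainder X Z Z' s t‖ ≤ K * (ω s t ^ (1 / r)) ^ 2)
    (hZ' : ∀ s t, s ≤ t → ‖Z' t - Z' s‖ ≤ K * ω s t ^ (1 / r))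
    {s t u : Icc (0 : ℝ) T} (hst : s ≤ t) (htu : t ≤ u) :
    ‖roughGerm X Z Z' s u - roughGerm X Z Z' s t - roughGerm X Z Z' t u‖
      ≤ (1 + (d : ℝ) ^ 2) * K * (ω s t ^ (1 / r) * ω t u ^ (1 / r) * ω s u ^ (1 / r)) := by
  rw [roughGerm_sub_sub h hr hst htu, norm_neg]
  have ha := h.rpow_mono hr.le le_rfl hst htu
  have hb := h.rpow_mono hr.le hst htu le_rfl
  have ha0 := h.rpow_nonneg s t
  have hb0 := h.rpow_nonneg t u
  have h1 := (remainder X Z Z' s t).le_opNorm (X.path u - X.path t)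
  have h2 := norm_tensorApply_le (Z' t - Z' s) (X.area t u)
  have h3 := hR s t hst
  have h4 := hZ' s t hst
  have h5 := h.norm_path_le t u htu
  have h6 := h.norm_area_le t u htu
  set a := ω s t ^ (1 / r)
  set b := ω t u ^ (1 / r)
  set c := ω s u ^ (1 / r)
  have e1 : ‖remainder X Z Z' s t (X.path u - X.path t)‖ ≤ K * (a * b * c) :=
    calc _ ≤ K * a ^ 2 * b := h1.trans (by gcongr)
      _ = K * (a * b * a) := by ring
      _ ≤ _ := by gcongr
  have e2 : ‖tensorApply (Z' t - Z' s) (X.area t u)‖ ≤ (d : ℝ) ^ 2 * K * (a * b * c) :=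
    calc _ ≤ (d : ℝ) ^ 2 * (K * a) * b ^ 2 := h2.trans (by gcongr)
      _ = (d : ℝ) ^ 2 * K * (a * b * b) := by ring
      _ ≤ _ := by gcongr
  refine (norm_add_le _ _).trans ((add_le_add e1 e2).trans (le_of_eq (by ring)))

lemma exists_roughIntegral [CompleteSpace F] (h : X.DominatedBy ω) (hr₂ : 2 ≤ r) (hr₃ : r < 3)
    {K : ℝ} (hK : 0 ≤ K)
    (hR : ∀ s t, s ≤ t → ‖remainder X Z Z' s t‖ ≤ K * (ω s t ^ (1 / r)) ^ 2)
    (hZ' : ∀ s t, s ≤ t → ‖Z' t - Z' s‖ ≤ K * ω s t ^ (1 / r)) :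
    ∃ I : Icc (0 : ℝ) T → Icc (0 : ℝ) T → F,
      (∀ a b, a ≤ b → HasRoughIntegral X Z Z' a b (I a b)) ∧
      (∀ a b c, a ≤ b → b ≤ c → I a c = I a b + I b c) ∧
      ∀ a b, a ≤ b → ‖I a b - roughGerm X Z Z' a b‖
        ≤ sewingConst (3 / r) * ((1 + (d : ℝ) ^ 2) * K) * (ω a b ^ (1 / r)) ^ 3 :=
  exists_sewing_of_cubic h.isControl hr₂ hr₃ (by positivity) fun _ _ _ hst htu =>
    norm_roughGerm_sub_sub_le h (by linarith) hK hR hZ' hst htu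

lemma HasRoughIntegral.unique {a b : Icc (0 : ℝ) T} (hab : a ≤ b) {I J : F}
    (hI : HasRoughIntegral X Z Z' a b I) (hJ : HasRoughIntegral X Z Z' a b J) : I = J := by
  have : Nonempty (IntervalPartition a b) := ⟨IntervalPartition.endpoints hab⟩
  exact tendsto_nhds_unique hI hJ

lemma HasRoughIntegral.sub {a b : Icc (0 : ℝ) T} {I J : F}
    (hI : HasRoughIntegral X Z Z' a b I) (hJ : HasRoughIntegral X W W' a b J) :
    HasRoughIntegral X (fun s => Z s - W s) (fun s => Z' s - W' s) a b (I - J) := by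
  refine (Tendsto.sub hI hJ).congr fun π => ?_
  rw [← partitionSum_sub]
  congr 1
  funext s t
  simp only [sub_apply, tensorApply_sub_left]
  abel

lemma roughGerm_sub (s t : Icc (0 : ℝ) T) :
    roughGerm X (fun s => Z s - W s) (fun s => Z' s - W' s) s t
      = roughGerm X Z Z' s t - roughGerm X W W' s t := by
  simp only [roughGerm, sub_apply, tensorApply_sub_left]
  abel

lemma remainder_sub (s t : Icc (0 : ℝ) T) :
    remainder X (fun s => Z s - W s) (fun s => Z' s - W' s) s t
      = remainder X Z Z' s t - remainder X W W' s t := by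
  simp only [remainder, sub_apply]
  abel

/-- The sewing estimate for the increments of an indefinite rough integral. -/
lemma norm_increment_sub_roughGerm_le [CompleteSpace F] (h : X.DominatedBy ω) (hr₂ : 2 ≤ r)
    (hr₃ : r < 3) {K : ℝ} (hK : 0 ≤ K)
    (hR : ∀ s t, s ≤ t → ‖remainder X Z Z' s t‖ ≤ K * (ω s t ^ (1 / r)) ^ 2)
    (hZ' : ∀ s t, s ≤ t → ‖Z' t - Z' s‖ ≤ K * ω s t ^ (1 / r))
    {o : Icc (0 : ℝ) T} (ho : ∀ t, o ≤ t) {J : Icc (0 : ℝ) T → F}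
    (hJ : ∀ t, HasRoughIntegral X Z Z' o t (J t)) {s t : Icc (0 : ℝ) T} (hst : s ≤ t) :
    ‖J t - J s - roughGerm X Z Z' s t‖
      ≤ sewingConst (3 / r) * ((1 + (d : ℝ) ^ 2) * K) * (ω s t ^ (1 / r)) ^ 3 := by
  obtain ⟨I, hI, hadd, hle⟩ := exists_roughIntegral h hr₂ hr₃ hK hR hZ'
  rw [(hJ t).unique (ho t) (hI o t (ho t)), (hJ s).unique (ho s) (hI o s (ho s)),
    hadd o s t (ho s) hst, add_sub_cancel_left]
  exact hle s t hst

end roughIntegral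

/-! ### The Picard map on controlled paths -/

/-- `(Y, Y')` is controlled by `X` with constant `B`, where increments and remainders are measured
by the control `ω` of the rough path, and `Y'` is bounded by `M`. -/
structure IsControlledBy {r T : ℝ} {d : ℕ} {E : Type*} [NormedAddCommGroup E] [NormedSpace ℝ E]
    (X : RoughPath r T d) (ω : Icc (0 : ℝ) T → Icc (0 : ℝ) T → ℝ) (M B : ℝ)
    (Y : Icc (0 : ℝ) T → E) (Y' : Icc (0 : ℝ) T → (EuclideanSpace ℝ (Fin d) →L[ℝ] E)) :
    Prop where
  norm_deriv_le : ∀ s, ‖Y' s‖ ≤ M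
  norm_deriv_sub_le : ∀ s t, s ≤ t → ‖Y' t - Y' s‖ ≤ B * ω s t ^ (1 / r)
  norm_remainder_le : ∀ s t, s ≤ t → ‖remainder X Y Y' s t‖ ≤ B * (ω s t ^ (1 / r)) ^ 2

/-- `(W, W')` is the image of `(Y, Y')` under the Picard map:
`W_t = y₀ + ∫_o^t φ(Y) dX` and `W'_t = φ(Y_t)`. -/
def IsPicardStep {r T : ℝ} {d : ℕ} {E : Type*} [NormedAddCommGroup E] [NormedSpace ℝ E]
    (X : RoughPath r T d) (φ : E → (EuclideanSpace ℝ (Fin d) →L[ℝ] E)) (o : Icc (0 : ℝ) T) (y₀ : E)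
    (Y : Icc (0 : ℝ) T → E) (Y' : Icc (0 : ℝ) T → (EuclideanSpace ℝ (Fin d) →L[ℝ] E))
    (W : Icc (0 : ℝ) T → E) (W' : Icc (0 : ℝ) T → (EuclideanSpace ℝ (Fin d) →L[ℝ] E)) : Prop :=
  ∀ t, HasRoughIntegral X (fun s => φ (Y s)) (fun s => (fderiv ℝ φ (Y s)).comp (Y' s)) o t
    (W t - y₀) ∧ W' t = φ (Y t)

section picard

variable {r T : ℝ} {d : ℕ} {E : Type*} [NormedAddCommGroup E] [NormedSpace ℝ E]
  {X : RoughPath r T d} {ω : Icc (0 : ℝ) T → Icc (0 : ℝ) T → ℝ}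
  {φ : E → (EuclideanSpace ℝ (Fin d) →L[ℝ] E)} {M B : ℝ} {o : Icc (0 : ℝ) T} {y₀ : E}
  {Y V W : Icc (0 : ℝ) T → E} {Y' V' W' : Icc (0 : ℝ) T → (EuclideanSpace ℝ (Fin d) →L[ℝ] E)}

lemma sub_eq_remainder_add (s t : Icc (0 : ℝ) T) :
    Y t - Y s = remainder X Y Y' s t + Y' s (X.path t - X.path s) := by
  simp [remainder]

namespace IsControlledBy

lemma norm_increment_le' (hY : IsControlledBy X ω M B Y Y') (h : X.DominatedBy ω) {s t : Icc (0 : ℝ) T}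
    (hst : s ≤ t) : ‖Y t - Y s‖ ≤ M * ω s t ^ (1 / r) + B * (ω s t ^ (1 / r)) ^ 2 := by
  rw [sub_eq_remainder_add (X := X) (Y' := Y'), add_comm (M * _)]
  have hM : 0 ≤ M := (norm_nonneg _).trans (hY.norm_deriv_le s)
  refine (norm_add_le _ _).trans (add_le_add (hY.norm_remainder_le s t hst)
    (((Y' s).le_opNorm _).trans ?_))
  exact mul_le_mul (hY.norm_deriv_le s) (h.norm_path_le s t hst) (norm_nonneg _) hM

lemma norm_increment_le (hY : IsControlledBy X ω M B Y Y') (h : X.DominatedBy ω) (hB : 0 ≤ B)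
    (hω : ∀ s t, s ≤ t → ω s t ^ (1 / r) ≤ 1) {s t : Icc (0 : ℝ) T} (hst : s ≤ t) :
    ‖Y t - Y s‖ ≤ (M + B) * ω s t ^ (1 / r) := by
  refine (hY.norm_increment_le' h hst).trans ?_
  have h1 := hω s t hst
  have h0 := h.rpow_nonneg s t
  rw [add_mul, sq]
  exact add_le_add le_rfl (mul_le_mul_of_nonneg_left (mul_le_of_le_one_left h0 h1) hB)

end IsControlledBy

lemma remainder_comp (s t : Icc (0 : ℝ) T) :
    remainder X (fun s => φ (Y s)) (fun s => (fderiv ℝ φ (Y s)).comp (Y' s)) s t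
      = (φ (Y t) - φ (Y s) - fderiv ℝ φ (Y s) (Y t - Y s))
        + fderiv ℝ φ (Y s) (remainder X Y Y' s t) := by
  simp only [remainder, ContinuousLinearMap.comp_apply, map_sub]
  abel

lemma comp_deriv_sub (s t : Icc (0 : ℝ) T) :
    (fderiv ℝ φ (Y t)).comp (Y' t) - (fderiv ℝ φ (Y s)).comp (Y' s)
      = (fderiv ℝ φ (Y t) - fderiv ℝ φ (Y s)).comp (Y' t)
        + (fderiv ℝ φ (Y s)).comp (Y' t - Y' s) := by
  rw [ContinuousLinearMap.sub_comp, ContinuousLinearMap.comp_sub]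
  abel

lemma norm_comp_le_of_le {G H K : Type*} [NormedAddCommGroup G] [NormedSpace ℝ G]
    [NormedAddCommGroup H] [NormedSpace ℝ H] [NormedAddCommGroup K] [NormedSpace ℝ K]
    (f : H →L[ℝ] K) (g : G →L[ℝ] H) {a b : ℝ} (hf : ‖f‖ ≤ a) (hg : ‖g‖ ≤ b) :
    ‖f.comp g‖ ≤ a * b :=
  (f.opNorm_comp_le g).trans (mul_le_mul hf hg (norm_nonneg _) ((norm_nonneg _).trans hf))

lemma norm_apply_le_of_le {H K : Type*} [NormedAddCommGroup H] [NormedSpace ℝ H]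
    [NormedAddCommGroup K] [NormedSpace ℝ K] (f : H →L[ℝ] K) (x : H) {a b : ℝ} (hf : ‖f‖ ≤ a)
    (hx : ‖x‖ ≤ b) : ‖f x‖ ≤ a * b :=
  (f.le_opNorm x).trans (mul_le_mul hf hx (norm_nonneg _) ((norm_nonneg _).trans hf))

lemma norm_remainder_comp_le (hφ : C21Bound φ M) (hY : IsControlledBy X ω M B Y Y')
    (h : X.DominatedBy ω) (hB : 0 ≤ B) (hω : ∀ s t, s ≤ t → ω s t ^ (1 / r) ≤ 1)
    (s t : Icc (0 : ℝ) T) (hst : s ≤ t) :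
    ‖remainder X (fun s => φ (Y s)) (fun s => (fderiv ℝ φ (Y s)).comp (Y' s)) s t‖
      ≤ 2 * M ^ 2 * (M + B) ^ 2 * (ω s t ^ (1 / r)) ^ 2 := by
  have hM := hφ.one_le
  have h1 := hY.norm_increment_le h hB hω hst
  rw [remainder_comp]
  set w := ω s t ^ (1 / r)
  set N := M + B with hN
  have hMN : M ≤ N := by linarith
  have hBN : B ≤ N := by linarith
  have h2 : M ≤ M ^ 2 := by nlinarith
  have h3 : N ≤ N ^ 2 := by nlinarith
  refine (norm_add_le _ _).trans ((add_le_add (hφ.taylor _ _) (norm_apply_le_of_le _ _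
    (hφ.norm_fderiv_le _) (hY.norm_remainder_le s t hst))).trans ?_)
  calc M * ‖Y t - Y s‖ ^ 2 + M * (B * w ^ 2) ≤ M ^ 2 * (N * w) ^ 2 + M ^ 2 * (N ^ 2 * w ^ 2) := by
        gcongr
        exact hBN.trans h3
    _ = _ := by ring

lemma norm_comp_deriv_sub_le (hφ : C21Bound φ M) (hY : IsControlledBy X ω M B Y Y')
    (h : X.DominatedBy ω) (hB : 0 ≤ B) (hω : ∀ s t, s ≤ t → ω s t ^ (1 / r) ≤ 1)
    (s t : Icc (0 : ℝ) T) (hst : s ≤ t) :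
    ‖(fderiv ℝ φ (Y t)).comp (Y' t) - (fderiv ℝ φ (Y s)).comp (Y' s)‖
      ≤ 2 * M ^ 2 * (M + B) ^ 2 * ω s t ^ (1 / r) := by
  have hM := hφ.one_le
  have h1 := hY.norm_increment_le h hB hω hst
  have hw := h.rpow_nonneg s t
  rw [comp_deriv_sub]
  set w := ω s t ^ (1 / r)
  set N := M + B with hN
  have hBN : B ≤ N := by linarith
  have h2 : M ≤ M ^ 2 := by nlinarith
  have h3 : N ≤ N ^ 2 := by nlinarith
  have h4 : 0 ≤ N := by linarith
  refine (norm_add_le _ _).trans ((add_le_add (norm_comp_le_of_le _ _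
    ((hφ.lipschitz_fderiv _ _).trans (mul_le_mul_of_nonneg_left h1 (by linarith)))
    (hY.norm_deriv_le t)) (norm_comp_le_of_le _ _ (hφ.norm_fderiv_le _)
    (hY.norm_deriv_sub_le s t hst))).trans ?_)
  calc M * (N * w) * M + M * (B * w) = M ^ 2 * (N * w) + M * (B * w) := by ring
    _ ≤ M ^ 2 * (N ^ 2 * w) + M ^ 2 * (N ^ 2 * w) := by
        gcongr
        exact hBN.trans h3
    _ = _ := by ring

/-- The constant in the estimate for the remainder of a Picard step. -/
noncomputable def picardConst (r : ℝ) (d : ℕ) (M B : ℝ) : ℝ :=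
  sewingConst (3 / r) * ((1 + (d : ℝ) ^ 2) * (2 * M ^ 2 * (M + B) ^ 2))

lemma sewingConst_three_div_nonneg {r : ℝ} (hr₂ : 2 ≤ r) (hr₃ : r < 3) :
    0 ≤ sewingConst (3 / r) := by
  have h : 1 < 3 / r := by rwa [lt_div_iff₀ (by linarith), one_mul]
  linarith [two_le_sewingConst h]

/-- The remainder of a Picard step. The second order term keeps the bound for `𝕏` itself, so that
`ω` may be larger than the control of the rough path. -/
lemma IsPicardStep.norm_remainder_le [CompleteSpace E] (hW : IsPicardStep X φ o y₀ Y Y' W W')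
    (ho : ∀ t, o ≤ t) (hr₂ : 2 ≤ r) (hr₃ : r < 3)
    (hφ : C21Bound φ M) (hY : IsControlledBy X ω M B Y Y')
    (h : X.DominatedBy ω) (hB : 0 ≤ B) (hω : ∀ s t, s ≤ t → ω s t ^ (1 / r) ≤ 1)
    {s t : Icc (0 : ℝ) T} (hst : s ≤ t) :
    ‖remainder X W W' s t‖
      ≤ picardConst r d M B * (ω s t ^ (1 / r)) ^ 3 + (d : ℝ) ^ 2 * M ^ 2 * ‖X.area s t‖ := by
  have hM := hφ.one_le
  have h1 := norm_increment_sub_roughGerm_le h hr₂ hr₃ (by positivity)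
    (norm_remainder_comp_le hφ hY h hB hω) (norm_comp_deriv_sub_le hφ hY h hB hω) ho
    (fun t => (hW t).1) hst
  have h2 := norm_tensorApply_le ((fderiv ℝ φ (Y s)).comp (Y' s)) (X.area s t)
  have h3 := norm_comp_le_of_le _ _ (hφ.norm_fderiv_le (Y s)) (hY.norm_deriv_le s)
  have hdec : remainder X W W' s t
      = (W t - y₀ - (W s - y₀) - roughGerm X (fun s => φ (Y s))
          (fun s => (fderiv ℝ φ (Y s)).comp (Y' s)) s t)
        + tensorApply ((fderiv ℝ φ (Y s)).comp (Y' s)) (X.area s t) := by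
    simp only [remainder, roughGerm, (hW s).2]
    abel
  rw [hdec]
  refine (norm_add_le _ _).trans (add_le_add h1 (h2.trans ?_))
  calc _ ≤ (d : ℝ) ^ 2 * (M * M) * ‖X.area s t‖ := by gcongr
    _ = _ := by ring

/-- The Picard map is defined on the controlled paths with constant `B` and preserves this class,
if the control of the rough path is small. -/
lemma IsControlledBy.exists_picardStep [CompleteSpace E] (hY : IsControlledBy X ω M B Y Y')
    (ho : ∀ t, o ≤ t) (hr₂ : 2 ≤ r) (hr₃ : r < 3) (hφ : C21Bound φ M) (h : X.DominatedBy ω)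
    {δ : ℝ} (hδ : δ ≤ 1) (hω : ∀ s t, s ≤ t → ω s t ^ (1 / r) ≤ δ)
    (hB₁ : 1 + (d : ℝ) ^ 2 * M ^ 2 ≤ B) (hB₂ : M * (M + 1) ≤ B) (hBδ : B * δ ≤ 1)
    (hCδ : picardConst r d M B * δ ≤ 1) (y₀ : E) :
    ∃ (W : Icc (0 : ℝ) T → E) (W' : Icc (0 : ℝ) T → (EuclideanSpace ℝ (Fin d) →L[ℝ] E)),
      IsPicardStep X φ o y₀ Y Y' W W' ∧ IsControlledBy X ω M B W W' ∧ W o = y₀ := by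
  have hM := hφ.one_le
  have hB : 0 ≤ B := le_trans (by positivity) hB₁
  have hω1 : ∀ s t, s ≤ t → ω s t ^ (1 / r) ≤ 1 := fun s t hst => (hω s t hst).trans hδ
  obtain ⟨I, hI, hadd, -⟩ := exists_roughIntegral h hr₂ hr₃ (by positivity)
    (norm_remainder_comp_le hφ hY h hB hω1) (norm_comp_deriv_sub_le hφ hY h hB hω1)
  have hstep : IsPicardStep X φ o y₀ Y Y' (fun t => y₀ + I o t) (fun t => φ (Y t)) := fun t =>
    ⟨by simpa using hI o t (ho t), rfl⟩
  refine ⟨_, _, hstep, ⟨fun s => hφ.norm_le _, fun s t hst => ?_, fun s t hst => ?_⟩, ?_⟩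
  · have h1 := hY.norm_increment_le' h hst
    have h2 := hω s t hst
    have h0 := h.rpow_nonneg s t
    set w := ω s t ^ (1 / r)
    refine (hφ.lipschitz _ _).trans ?_
    calc M * ‖Y t - Y s‖ ≤ M * (M * w + B * w ^ 2) := by gcongr
      _ = M * (M + B * w) * w := by ring
      _ ≤ M * (M + B * δ) * w := by gcongr
      _ ≤ M * (M + 1) * w := by gcongr
      _ ≤ B * w := by gcongr
  · refine (hstep.norm_remainder_le ho hr₂ hr₃ hφ hY h hB hω1 hst).trans ?_
    have h1 := h.norm_area_le s t hst
    have h2 := hω s t hst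
    have h0 := h.rpow_nonneg s t
    have hC : 0 ≤ picardConst r d M B := by
      have := sewingConst_three_div_nonneg hr₂ hr₃
      unfold picardConst
      positivity
    set w := ω s t ^ (1 / r)
    calc picardConst r d M B * w ^ 3 + (d : ℝ) ^ 2 * M ^ 2 * ‖X.area s t‖
        ≤ picardConst r d M B * w ^ 3 + (d : ℝ) ^ 2 * M ^ 2 * w ^ 2 := by gcongr
      _ = (picardConst r d M B * w + (d : ℝ) ^ 2 * M ^ 2) * w ^ 2 := by ring
      _ ≤ (picardConst r d M B * δ + (d : ℝ) ^ 2 * M ^ 2) * w ^ 2 := by gcongr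
      _ ≤ (1 + (d : ℝ) ^ 2 * M ^ 2) * w ^ 2 := by gcongr
      _ ≤ B * w ^ 2 := by gcongr
  · have := hadd o o o le_rfl le_rfl
    simpa using this

/-! ### Contraction of the Picard map -/

/-- The distance of two controlled paths is at most `e`, in the seminorm that measures the
increments of the derivative and the remainder by the control of the rough path. -/
def IsCloseBy (X : RoughPath r T d) (ω : Icc (0 : ℝ) T → Icc (0 : ℝ) T → ℝ) (e : ℝ)
    (Y : Icc (0 : ℝ) T → E) (Y' : Icc (0 : ℝ) T → (EuclideanSpace ℝ (Fin d) →L[ℝ] E))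
    (V : Icc (0 : ℝ) T → E) (V' : Icc (0 : ℝ) T → (EuclideanSpace ℝ (Fin d) →L[ℝ] E)) : Prop :=
  ∀ s t, s ≤ t → ‖(Y' t - Y' s) - (V' t - V' s)‖ ≤ e * ω s t ^ (1 / r) ∧
    ‖remainder X Y Y' s t - remainder X V V' s t‖ ≤ e * (ω s t ^ (1 / r)) ^ 2

lemma IsControlledBy.isCloseBy (hY : IsControlledBy X ω M B Y Y')
    (hV : IsControlledBy X ω M B V V') : IsCloseBy X ω (2 * B) Y Y' V V' := fun s t hst => by
  have h1 := (norm_sub_le _ _).trans (add_le_add (hY.norm_deriv_sub_le s t hst)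
    (hV.norm_deriv_sub_le s t hst))
  have h2 := (norm_sub_le _ _).trans (add_le_add (hY.norm_remainder_le s t hst)
    (hV.norm_remainder_le s t hst))
  constructor <;> linarith

namespace IsCloseBy

variable {e δ : ℝ}

lemma norm_deriv_sub_le (hc : IsCloseBy X ω e Y Y' V V') (ho : ∀ t, o ≤ t) (he : 0 ≤ e)
    (hω : ∀ s t, s ≤ t → ω s t ^ (1 / r) ≤ δ) (h' : Y' o = V' o) (t : Icc (0 : ℝ) T) :
    ‖Y' t - V' t‖ ≤ e * δ := by
  have h1 := (hc o t (ho t)).1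
  rw [h', sub_sub_sub_cancel_right] at h1
  exact h1.trans (mul_le_mul_of_nonneg_left (hω o t (ho t)) he)

lemma norm_increments_sub_le (hc : IsCloseBy X ω e Y Y' V V') (h : X.DominatedBy ω)
    (ho : ∀ t, o ≤ t) (he : 0 ≤ e) (hω : ∀ s t, s ≤ t → ω s t ^ (1 / r) ≤ δ) (h' : Y' o = V' o)
    {s t : Icc (0 : ℝ) T} (hst : s ≤ t) :
    ‖(Y t - Y s) - (V t - V s)‖ ≤ 2 * e * δ * ω s t ^ (1 / r) := by
  have h1 := (hc s t hst).2
  have h2 := norm_apply_le_of_le _ _ (hc.norm_deriv_sub_le ho he hω h' s) (h.norm_path_le s t hst)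
  have h3 := h.rpow_nonneg s t
  have h4 := hω s t hst
  have h5 : (Y t - Y s) - (V t - V s) = (remainder X Y Y' s t - remainder X V V' s t)
      + (Y' s - V' s) (X.path t - X.path s) := by
    simp only [remainder, sub_apply]
    abel
  rw [h5]
  set w := ω s t ^ (1 / r)
  refine (norm_add_le _ _).trans ((add_le_add h1 h2).trans ?_)
  calc e * w ^ 2 + e * δ * w = (e * w + e * δ) * w := by ring
    _ ≤ (e * δ + e * δ) * w := by gcongr
    _ = _ := by ring

lemma norm_path_sub_le (hc : IsCloseBy X ω e Y Y' V V') (h : X.DominatedBy ω)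
    (ho : ∀ t, o ≤ t) (he : 0 ≤ e) (hδ : δ ≤ 1) (hω : ∀ s t, s ≤ t → ω s t ^ (1 / r) ≤ δ)
    (h₀ : Y o = V o) (h' : Y' o = V' o) (t : Icc (0 : ℝ) T) : ‖Y t - V t‖ ≤ 2 * e * δ := by
  have h1 := hc.norm_increments_sub_le h ho he hω h' (ho t)
  have h2 := (hω o t (ho t)).trans hδ
  have h3 : 0 ≤ δ := (h.rpow_nonneg o t).trans (hω o t (ho t))
  rw [h₀, sub_sub_sub_cancel_right] at h1
  exact h1.trans (mul_le_of_le_one_right (by positivity) h2)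

lemma norm_remainder_comp_sub_le (hc : IsCloseBy X ω e Y Y' V V') (hφ : C21Bound φ M)
    (hY : IsControlledBy X ω M B Y Y') (hV : IsControlledBy X ω M B V V')
    (h : X.DominatedBy ω) (ho : ∀ t, o ≤ t) (hB : 0 ≤ B) (he : 0 ≤ e) (hδ : δ ≤ 1)
    (hω : ∀ s t, s ≤ t → ω s t ^ (1 / r) ≤ δ) (h₀ : Y o = V o) (h' : Y' o = V' o)
    (s t : Icc (0 : ℝ) T) (hst : s ≤ t) :
    ‖remainder X (fun s => φ (Y s)) (fun s => (fderiv ℝ φ (Y s)).comp (Y' s)) s t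
      - remainder X (fun s => φ (V s)) (fun s => (fderiv ℝ φ (V s)).comp (V' s)) s t‖
      ≤ 9 * M ^ 2 * (M + B) ^ 2 * e * (ω s t ^ (1 / r)) ^ 2 := by
  have hM := hφ.one_le
  have hω1 : ∀ s t, s ≤ t → ω s t ^ (1 / r) ≤ 1 := fun s t hst => (hω s t hst).trans hδ
  have y1 := hY.norm_increment_le h hB hω1 hst
  have v1 := hV.norm_increment_le h hB hω1 hst
  have d1 := hc.norm_increments_sub_le h ho he hω h' hst
  have d2 := hc.norm_path_sub_le h ho he hδ hω h₀ h' s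
  have d3 := (hc s t hst).2
  have r1 := hY.norm_remainder_le s t hst
  have t1 := hφ.taylor_sub (Y s) (V s) (Y t) (V t)
  have w0 := h.rpow_nonneg s t
  have δ0 : 0 ≤ δ := w0.trans (hω s t hst)
  have w1 := hω s t hst
  have s1 := norm_apply_le_of_le _ _ (hφ.lipschitz_fderiv (Y s) (V s)) r1
  have s2 := norm_apply_le_of_le _ _ (hφ.norm_fderiv_le (V s)) d3
  have hdec : remainder X (fun s => φ (Y s)) (fun s => (fderiv ℝ φ (Y s)).comp (Y' s)) s t
      - remainder X (fun s => φ (V s)) (fun s => (fderiv ℝ φ (V s)).comp (V' s)) s t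
      = ((φ (Y t) - φ (Y s) - fderiv ℝ φ (Y s) (Y t - Y s))
          - (φ (V t) - φ (V s) - fderiv ℝ φ (V s) (V t - V s)))
        + ((fderiv ℝ φ (Y s) - fderiv ℝ φ (V s)) (remainder X Y Y' s t)
          + fderiv ℝ φ (V s) (remainder X Y Y' s t - remainder X V V' s t)) := by
    rw [remainder_comp, remainder_comp, sub_apply,
      map_sub (fderiv ℝ φ (V s)) (remainder X Y Y' s t)]
    abel
  rw [hdec]
  refine (norm_add_le _ _).trans ((add_le_add t1 ((norm_add_le _ _).trans
    (add_le_add s1 s2))).trans ?_)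
  set w := ω s t ^ (1 / r)
  set N := M + B with hN
  have hBN : B ≤ N := by linarith
  have hN1 : 1 ≤ N := by linarith
  have hMM : M ≤ M ^ 2 := by nlinarith
  have d1' : ‖Y t - Y s - (V t - V s)‖ ≤ 2 * e * w := d1.trans (by
    have : 2 * e * δ * w ≤ 2 * e * 1 * w := by gcongr
    linarith)
  have d2' : ‖Y s - V s‖ ≤ 2 * e := d2.trans (mul_le_of_le_one_right (by positivity) hδ)
  calc _ ≤ M * (N * w + N * w) * (2 * e * w) + M * (N * w) ^ 2 * (2 * e)
        + (M * (2 * e) * (B * w ^ 2) + M * (e * w ^ 2)) := by gcongr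
    _ = M * (4 * N + 2 * N ^ 2 + 2 * B + 1) * e * w ^ 2 := by ring
    _ ≤ M ^ 2 * (9 * N ^ 2) * e * w ^ 2 := by
        gcongr
        nlinarith
    _ = _ := by ring

lemma norm_comp_deriv_sub_sub_le (hc : IsCloseBy X ω e Y Y' V V') (hφ : C21Bound φ M)
    (hY : IsControlledBy X ω M B Y Y') (hV : IsControlledBy X ω M B V V')
    (h : X.DominatedBy ω) (ho : ∀ t, o ≤ t) (hB : 0 ≤ B) (he : 0 ≤ e) (hδ : δ ≤ 1)
    (hω : ∀ s t, s ≤ t → ω s t ^ (1 / r) ≤ δ) (h₀ : Y o = V o) (h' : Y' o = V' o)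
    (s t : Icc (0 : ℝ) T) (hst : s ≤ t) :
    ‖((fderiv ℝ φ (Y t)).comp (Y' t) - (fderiv ℝ φ (V t)).comp (V' t))
      - ((fderiv ℝ φ (Y s)).comp (Y' s) - (fderiv ℝ φ (V s)).comp (V' s))‖
      ≤ 9 * M ^ 2 * (M + B) ^ 2 * e * ω s t ^ (1 / r) := by
  have hM := hφ.one_le
  have hω1 : ∀ s t, s ≤ t → ω s t ^ (1 / r) ≤ 1 := fun s t hst => (hω s t hst).trans hδ
  have v1 := hV.norm_increment_le h hB hω1 hst
  have d1 := hc.norm_increments_sub_le h ho he hω h' hst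
  have d2 := hc.norm_path_sub_le h ho he hδ hω h₀ h' s
  have d3 := (hc s t hst).1
  have d4 := hc.norm_deriv_sub_le ho he hω h' t
  have r1 := hY.norm_deriv_sub_le s t hst
  have w0 := h.rpow_nonneg s t
  have δ0 : 0 ≤ δ := w0.trans (hω s t hst)
  have hdec : ((fderiv ℝ φ (Y t)).comp (Y' t) - (fderiv ℝ φ (V t)).comp (V' t))
      - ((fderiv ℝ φ (Y s)).comp (Y' s) - (fderiv ℝ φ (V s)).comp (V' s))
      = (((fderiv ℝ φ (Y t) - fderiv ℝ φ (Y s)) - (fderiv ℝ φ (V t) - fderiv ℝ φ (V s))).comp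
            (Y' t)
          + (fderiv ℝ φ (V t) - fderiv ℝ φ (V s)).comp (Y' t - V' t))
        + ((fderiv ℝ φ (Y s) - fderiv ℝ φ (V s)).comp (Y' t - Y' s)
          + (fderiv ℝ φ (V s)).comp ((Y' t - Y' s) - (V' t - V' s))) := by
    simp only [ContinuousLinearMap.sub_comp, ContinuousLinearMap.comp_sub]
    abel
  have s1 := norm_comp_le_of_le _ _ (hφ.increments_fderiv_sub (Y s) (V s) (Y t) (V t))
    (hY.norm_deriv_le t)
  have s2 := norm_comp_le_of_le _ _ (hφ.lipschitz_fderiv (V t) (V s)) d4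
  have s3 := norm_comp_le_of_le _ _ (hφ.lipschitz_fderiv (Y s) (V s)) r1
  have s4 := norm_comp_le_of_le _ _ (hφ.norm_fderiv_le (V s)) d3
  rw [hdec]
  refine (norm_add_le _ _).trans ((add_le_add ((norm_add_le _ _).trans (add_le_add s1 s2))
    ((norm_add_le _ _).trans (add_le_add s3 s4))).trans ?_)
  set w := ω s t ^ (1 / r)
  set N := M + B with hN
  have hBN : B ≤ N := by linarith
  have hN1 : 1 ≤ N := by linarith
  have hMM : M ≤ M ^ 2 := by nlinarith
  have d1' : ‖Y t - Y s - (V t - V s)‖ ≤ 2 * e * w := d1.trans (by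
    have : 2 * e * δ * w ≤ 2 * e * 1 * w := by gcongr
    linarith)
  have d2' : ‖Y s - V s‖ ≤ 2 * e := d2.trans (mul_le_of_le_one_right (by positivity) hδ)
  have d4' : e * δ ≤ e := mul_le_of_le_one_right he hδ
  calc _ ≤ (M * (2 * e * w) + M * (N * w) * (2 * e)) * M + M * (N * w) * e
        + (M * (2 * e) * (B * w) + M * (e * w)) := by gcongr
    _ = (M ^ 2 * (2 + 2 * N) + M * (N + 2 * B + 1)) * e * w := by ring
    _ ≤ (M ^ 2 * (2 + 2 * N) + M ^ 2 * (N + 2 * B + 1)) * e * w := by gcongr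
    _ = M ^ 2 * (3 + 3 * N + 2 * B) * e * w := by ring
    _ ≤ M ^ 2 * (9 * N ^ 2) * e * w := by
        gcongr
        nlinarith
    _ = _ := by ring

lemma norm_comp_sub_le (hc : IsCloseBy X ω e Y Y' V V') (hφ : C21Bound φ M)
    (hY : IsControlledBy X ω M B Y Y')
    (h : X.DominatedBy ω) (ho : ∀ t, o ≤ t) (he : 0 ≤ e) (hδ : δ ≤ 1)
    (hω : ∀ s t, s ≤ t → ω s t ^ (1 / r) ≤ δ) (h₀ : Y o = V o) (h' : Y' o = V' o)
    (s : Icc (0 : ℝ) T) :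
    ‖(fderiv ℝ φ (Y s)).comp (Y' s) - (fderiv ℝ φ (V s)).comp (V' s)‖ ≤ 3 * M ^ 2 * e * δ := by
  have hM := hφ.one_le
  have d2 := hc.norm_path_sub_le h ho he hδ hω h₀ h' s
  have d4 := hc.norm_deriv_sub_le ho he hω h' s
  have δ0 : 0 ≤ δ := (h.rpow_nonneg s s).trans (hω s s le_rfl)
  have s1 := norm_comp_le_of_le _ _ (hφ.lipschitz_fderiv (Y s) (V s)) (hY.norm_deriv_le s)
  have s2 := norm_comp_le_of_le _ _ (hφ.norm_fderiv_le (V s)) d4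
  have hdec : (fderiv ℝ φ (Y s)).comp (Y' s) - (fderiv ℝ φ (V s)).comp (V' s)
      = (fderiv ℝ φ (Y s) - fderiv ℝ φ (V s)).comp (Y' s)
        + (fderiv ℝ φ (V s)).comp (Y' s - V' s) := by
    simp only [ContinuousLinearMap.sub_comp, ContinuousLinearMap.comp_sub]
    abel
  rw [hdec]
  refine (norm_add_le _ _).trans ((add_le_add s1 s2).trans ?_)
  calc M * ‖Y s - V s‖ * M + M * (e * δ) ≤ M * (2 * e * δ) * M + M ^ 2 * (e * δ) := by
        gcongr
        nlinarith
    _ = _ := by ring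

end IsCloseBy

/-- The Picard map has Lipschitz constant at most `contractionConst r d M B * δ` on the controlled
paths with constant `B`, where `δ` bounds the control of the rough path. -/
noncomputable def contractionConst (r : ℝ) (d : ℕ) (M B : ℝ) : ℝ :=
  sewingConst (3 / r) * ((1 + (d : ℝ) ^ 2) * (9 * M ^ 2 * (M + B) ^ 2))
    + 3 * (d : ℝ) ^ 2 * M ^ 2 + 4 * M * (M + B)

/-- The Picard map halves distances between controlled paths with the same initial values. The
integrand is linear in the pair, so that the sewing estimate applies to the difference of the
two integrals. -/
lemma IsPicardStep.isCloseBy [CompleteSpace E] {U : Icc (0 : ℝ) T → E}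
    {U' : Icc (0 : ℝ) T → (EuclideanSpace ℝ (Fin d) →L[ℝ] E)} {e δ : ℝ}
    (hW : IsPicardStep X φ o y₀ Y Y' W W') (hU : IsPicardStep X φ o y₀ V V' U U')
    (hc : IsCloseBy X ω e Y Y' V V') (hr₂ : 2 ≤ r) (hr₃ : r < 3) (hφ : C21Bound φ M)
    (hY : IsControlledBy X ω M B Y Y') (hV : IsControlledBy X ω M B V V')
    (h : X.DominatedBy ω) (ho : ∀ t, o ≤ t) (hB : 0 ≤ B) (he : 0 ≤ e) (hδ : δ ≤ 1)
    (hω : ∀ s t, s ≤ t → ω s t ^ (1 / r) ≤ δ) (hCδ : contractionConst r d M B * δ ≤ 1 / 2)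
    (h₀ : Y o = V o) (h' : Y' o = V' o) : IsCloseBy X ω (e / 2) W W' U U' := by
  intro s t hst
  have hM := hφ.one_le
  have hω1 : ∀ s t, s ≤ t → ω s t ^ (1 / r) ≤ 1 := fun s t hst => (hω s t hst).trans hδ
  have hC := sewingConst_three_div_nonneg hr₂ hr₃
  have w0 := h.rpow_nonneg s t
  have wδ := hω s t hst
  have δ0 : 0 ≤ δ := w0.trans wδ
  constructor
  · have v1 := hV.norm_increment_le h hB hω1 hst
    have d1 := hc.norm_increments_sub_le h ho he hω h' hst
    have d2 := hc.norm_path_sub_le h ho he hδ hω h₀ h' s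
    rw [(hW t).2, (hW s).2, (hU t).2, (hU s).2]
    refine (hφ.increments_sub (Y s) (V s) (Y t) (V t)).trans ?_
    set w := ω s t ^ (1 / r)
    set N := M + B with hN
    have hN1 : 1 ≤ N := by linarith
    have hle : 4 * M * N ≤ contractionConst r d M B := by
      have : 0 ≤ sewingConst (3 / r) * ((1 + (d : ℝ) ^ 2) * (9 * M ^ 2 * N ^ 2))
        + 3 * (d : ℝ) ^ 2 * M ^ 2 := by positivity
      unfold contractionConst
      linarith
    calc _ ≤ M * (2 * e * δ * w) + M * (N * w) * (2 * e * δ) := by gcongr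
      _ = 2 * M * (1 + N) * δ * e * w := by ring
      _ ≤ 2 * M * (N + N) * δ * e * w := by gcongr
      _ = 4 * M * N * δ * e * w := by ring
      _ ≤ contractionConst r d M B * δ * e * w := by gcongr
      _ ≤ 1 / 2 * e * w := by gcongr
      _ = _ := by ring
  · have h1 := norm_increment_sub_roughGerm_le h hr₂ hr₃
      (K := 9 * M ^ 2 * (M + B) ^ 2 * e) (by positivity)
      (fun s t hst => by
        rw [remainder_sub]
        exact hc.norm_remainder_comp_sub_le hφ hY hV h ho hB he hδ hω h₀ h' s t hst)
      (fun s t hst =>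
        hc.norm_comp_deriv_sub_sub_le hφ hY hV h ho hB he hδ hω h₀ h' s t hst) ho
      (fun t => (hW t).1.sub (hU t).1) hst
    have h2 := norm_tensorApply_le ((fderiv ℝ φ (Y s)).comp (Y' s)
      - (fderiv ℝ φ (V s)).comp (V' s)) (X.area s t)
    have h3 := hc.norm_comp_sub_le hφ hY h ho he hδ hω h₀ h' s
    have h4 := h.norm_area_le s t hst
    rw [roughGerm_sub] at h1
    have hdec : remainder X W W' s t - remainder X U U' s t
        = (W t - y₀ - (U t - y₀) - (W s - y₀ - (U s - y₀))
            - (roughGerm X (fun s => φ (Y s)) (fun s => (fderiv ℝ φ (Y s)).comp (Y' s)) s t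
              - roughGerm X (fun s => φ (V s)) (fun s => (fderiv ℝ φ (V s)).comp (V' s)) s t))
          + tensorApply ((fderiv ℝ φ (Y s)).comp (Y' s) - (fderiv ℝ φ (V s)).comp (V' s))
              (X.area s t) := by
      simp only [remainder, roughGerm, (hW s).2, (hU s).2, tensorApply_sub_left]
      abel
    rw [hdec]
    refine (norm_add_le _ _).trans ((add_le_add h1 h2).trans ?_)
    set w := ω s t ^ (1 / r)
    set N := M + B with hN
    have hN1 : 1 ≤ N := by linarith
    have hle : sewingConst (3 / r) * ((1 + (d : ℝ) ^ 2) * (9 * M ^ 2 * N ^ 2))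
        + 3 * (d : ℝ) ^ 2 * M ^ 2 ≤ contractionConst r d M B := by
      have : 0 ≤ 4 * M * N := by positivity
      unfold contractionConst
      linarith
    calc _ ≤ sewingConst (3 / r) * ((1 + (d : ℝ) ^ 2) * (9 * M ^ 2 * N ^ 2 * e)) * (w ^ 2 * δ)
          + (d : ℝ) ^ 2 * (3 * M ^ 2 * e * δ) * w ^ 2 := by
          rw [pow_succ w 2]
          gcongr
      _ = (sewingConst (3 / r) * ((1 + (d : ℝ) ^ 2) * (9 * M ^ 2 * N ^ 2))
          + 3 * (d : ℝ) ^ 2 * M ^ 2) * δ * e * w ^ 2 := by ring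
      _ ≤ contractionConst r d M B * δ * e * w ^ 2 := by gcongr
      _ ≤ 1 / 2 * e * w ^ 2 := by gcongr
      _ = _ := by ring

end picard

/-! ### Existence and uniqueness among paths controlled by `ω` -/

lemma HasRoughIntegral.eq_zero_of_self {r T : ℝ} {d : ℕ} {X : RoughPath r T d} {F : Type*}
    [NormedAddCommGroup F] [NormedSpace ℝ F]
    {Z : Icc (0 : ℝ) T → (EuclideanSpace ℝ (Fin d) →L[ℝ] F)}
    {Z' : Icc (0 : ℝ) T →
      (EuclideanSpace ℝ (Fin d) →L[ℝ] (EuclideanSpace ℝ (Fin d) →L[ℝ] F))}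
    {a : Icc (0 : ℝ) T} {I : F} (hI : HasRoughIntegral X Z Z' a a I) : I = 0 := by
  have : Nonempty (IntervalPartition a a) := ⟨IntervalPartition.endpoints le_rfl⟩
  refine tendsto_nhds_unique hI (tendsto_const_nhds.congr fun π => ?_)
  have hπ : π.1 = {a} := by
    ext x
    rw [Finset.mem_singleton]
    refine ⟨fun hx => le_antisymm (π.2.2.2 x hx).2 (π.2.2.2 x hx).1, fun hx => ?_⟩
    rw [hx]
    exact π.2.1
  simp [partitionSum, hπ]

section fixedPoint

variable {r T : ℝ} {d : ℕ} {E : Type*} [NormedAddCommGroup E] [NormedSpace ℝ E]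
  {X : RoughPath r T d} {ω : Icc (0 : ℝ) T → Icc (0 : ℝ) T → ℝ}
  {φ : E → (EuclideanSpace ℝ (Fin d) →L[ℝ] E)} {M B δ : ℝ} {o : Icc (0 : ℝ) T} {y₀ : E}
  {Y V : Icc (0 : ℝ) T → E} {Y' V' : Icc (0 : ℝ) T → (EuclideanSpace ℝ (Fin d) →L[ℝ] E)}

lemma IsPicardStep.initial (hY : IsPicardStep X φ o y₀ Y Y' V V') : V o = y₀ :=
  sub_eq_zero.1 (hY o).1.eq_zero_of_self

lemma tendsto_const_mul_half_pow (c : ℝ) : Tendsto (fun n : ℕ => c * (1 / 2) ^ n) atTop (𝓝 0) := by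
  simpa using (tendsto_pow_atTop_nhds_zero_of_lt_one (r := (1 / 2 : ℝ)) (by norm_num)
    (by norm_num)).const_mul c

theorem IsPicardStep.unique [CompleteSpace E] (hY : IsPicardStep X φ o y₀ Y Y' Y Y')
    (hV : IsPicardStep X φ o y₀ V V' V V') (hr₂ : 2 ≤ r) (hr₃ : r < 3) (hφ : C21Bound φ M)
    (hYB : IsControlledBy X ω M B Y Y') (hVB : IsControlledBy X ω M B V V')
    (h : X.DominatedBy ω) (ho : ∀ t, o ≤ t) (hB : 0 ≤ B) (hδ : δ ≤ 1)
    (hω : ∀ s t, s ≤ t → ω s t ^ (1 / r) ≤ δ) (hCδ : contractionConst r d M B * δ ≤ 1 / 2) :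
    Y = V ∧ Y' = V' := by
  have h₀ : Y o = V o := hY.initial.trans hV.initial.symm
  have h' : Y' o = V' o := by rw [(hY o).2, (hV o).2, h₀]
  have hclose : ∀ n : ℕ, IsCloseBy X ω (2 * B * (1 / 2) ^ n) Y Y' V V' := by
    intro n
    induction n with
    | zero => simpa using hYB.isCloseBy hVB
    | succ n ih =>
      have := hY.isCloseBy hV ih hr₂ hr₃ hφ hYB hVB h ho hB (by positivity) hδ hω hCδ h₀ h'
      rwa [pow_succ, ← mul_assoc, mul_one_div]
  have hYV : Y = V := by
    funext t
    have hlim : Tendsto (fun n : ℕ => 2 * (2 * B * (1 / 2) ^ n) * δ) atTop (𝓝 0) :=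
      (tendsto_const_mul_half_pow (4 * B * δ)).congr fun n => by ring
    have := ge_of_tendsto' hlim fun n =>
      (hclose n).norm_path_sub_le h ho (by positivity) hδ hω h₀ h' t
    exact sub_eq_zero.1 (norm_le_zero_iff.1 this)
  refine ⟨hYV, ?_⟩
  funext t
  rw [(hY t).2, (hV t).2, hYV]

/-- The Picard iteration converges to a fixed point. -/
theorem exists_isPicardStep_self [CompleteSpace E] (hr₂ : 2 ≤ r) (hr₃ : r < 3)
    (hφ : C21Bound φ M) (h : X.DominatedBy ω) (ho : ∀ t, o ≤ t) (hδ : δ ≤ 1)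
    (hω : ∀ s t, s ≤ t → ω s t ^ (1 / r) ≤ δ)
    (hB₁ : 1 + (d : ℝ) ^ 2 * M ^ 2 ≤ B) (hB₂ : M * (M + 1) ≤ B) (hBδ : B * δ ≤ 1)
    (hPδ : picardConst r d M B * δ ≤ 1) (hCδ : contractionConst r d M B * δ ≤ 1 / 2) (y₀ : E) :
    ∃ (W : Icc (0 : ℝ) T → E) (W' : Icc (0 : ℝ) T → (EuclideanSpace ℝ (Fin d) →L[ℝ] E)),
      IsPicardStep X φ o y₀ W W' W W' ∧ IsControlledBy X ω M B W W' := by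
  have hB : 0 ≤ B := le_trans (by positivity) hB₁
  let S := {p : (Icc (0 : ℝ) T → E) × (Icc (0 : ℝ) T → (EuclideanSpace ℝ (Fin d) →L[ℝ] E)) //
    IsControlledBy X ω M B p.1 p.2 ∧ p.1 o = y₀ ∧ p.2 o = φ y₀}
  have hstep : ∀ p : S, ∃ q : S, IsPicardStep X φ o y₀ p.1.1 p.1.2 q.1.1 q.1.2 := by
    intro p
    obtain ⟨W, W', hW, hWB, hW₀⟩ :=
      p.2.1.exists_picardStep ho hr₂ hr₃ hφ h hδ hω hB₁ hB₂ hBδ hPδ y₀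
    exact ⟨⟨(W, W'), hWB, hW₀, (hW o).2.trans (congrArg φ p.2.2.1)⟩, hW⟩
  choose Φ hΦ using hstep
  have hstart : IsControlledBy X ω M B (fun t => y₀ + φ y₀ (X.path t - X.path o))
      (fun _ => φ y₀) := by
    refine ⟨fun _ => hφ.norm_le _, fun s t _ => ?_, fun s t _ => ?_⟩
    · rw [sub_self, norm_zero]
      exact mul_nonneg hB (h.rpow_nonneg s t)
    · have : remainder X (fun t => y₀ + φ y₀ (X.path t - X.path o)) (fun _ => φ y₀) s t = 0 := by
        simp only [remainder, map_sub]
        abel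
      rw [this, norm_zero]
      exact mul_nonneg hB (sq_nonneg _)
  let p : ℕ → S := fun n => Φ^[n] ⟨(_, _), hstart, by simp, rfl⟩
  have hp : ∀ n, p (n + 1) = Φ (p n) := fun n => Function.iterate_succ_apply' Φ n _
  have hcontr : ∀ {a b : S} {e : ℝ}, 0 ≤ e → IsCloseBy X ω e a.1.1 a.1.2 b.1.1 b.1.2 →
      IsCloseBy X ω (e / 2) (Φ a).1.1 (Φ a).1.2 (Φ b).1.1 (Φ b).1.2 := fun {a b} _ he hab =>
    (hΦ a).isCloseBy (hΦ b) hab hr₂ hr₃ hφ a.2.1 b.2.1 h ho hB he hδ hω hCδ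
      (a.2.2.1.trans b.2.2.1.symm) (a.2.2.2.trans b.2.2.2.symm)
  have hclose : ∀ n k, IsCloseBy X ω (2 * B * (1 / 2) ^ n) (p n).1.1 (p n).1.2
      (p (n + k)).1.1 (p (n + k)).1.2 := by
    intro n k
    induction n with
    | zero => simpa using (p 0).2.1.isCloseBy (p (0 + k)).2.1
    | succ n ih =>
      have := hcontr (by positivity) ih
      rwa [← hp, ← hp, add_right_comm, mul_div_assoc, div_eq_mul_one_div ((1 / 2 : ℝ) ^ n),
        ← pow_succ] at this
  have hδ0 : 0 ≤ δ := (h.rpow_nonneg o o).trans (hω o o le_rfl)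
  have hpath : ∀ {a b : S} {e : ℝ}, 0 ≤ e → IsCloseBy X ω e a.1.1 a.1.2 b.1.1 b.1.2 → ∀ t,
      ‖a.1.1 t - b.1.1 t‖ ≤ 2 * e * δ ∧ ‖a.1.2 t - b.1.2 t‖ ≤ e * δ := fun {a b} _ he hab t =>
    ⟨hab.norm_path_sub_le h ho he hδ hω (a.2.2.1.trans b.2.2.1.symm)
      (a.2.2.2.trans b.2.2.2.symm) t,
      hab.norm_deriv_sub_le ho he hω (a.2.2.2.trans b.2.2.2.symm) t⟩
  have hlim₁ : Tendsto (fun n : ℕ => 2 * (2 * B * (1 / 2) ^ n) * δ) atTop (𝓝 0) :=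
    (tendsto_const_mul_half_pow (4 * B * δ)).congr fun n => by ring
  have hlim₂ : Tendsto (fun n : ℕ => 2 * B * (1 / 2) ^ n * δ) atTop (𝓝 0) :=
    (tendsto_const_mul_half_pow (2 * B * δ)).congr fun n => by ring
  have hex₁ : ∀ t, ∃ y, Tendsto (fun n => (p n).1.1 t) atTop (𝓝 y) := fun t =>
    cauchySeq_tendsto_of_complete (cauchySeq_of_le_tendsto_0' _ (fun n m hnm => by
      obtain ⟨k, rfl⟩ := Nat.exists_eq_add_of_le hnm
      rw [dist_eq_norm]
      exact (hpath (by positivity) (hclose n k) t).1) hlim₁)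
  have hex₂ : ∀ t, ∃ y, Tendsto (fun n => (p n).1.2 t) atTop (𝓝 y) := fun t =>
    cauchySeq_tendsto_of_complete (cauchySeq_of_le_tendsto_0' _ (fun n m hnm => by
      obtain ⟨k, rfl⟩ := Nat.exists_eq_add_of_le hnm
      rw [dist_eq_norm]
      exact (hpath (by positivity) (hclose n k) t).2) hlim₂)
  choose Y hY using hex₁
  choose Y' hY' using hex₂
  have hrem : ∀ s t, Tendsto (fun n => remainder X (p n).1.1 (p n).1.2 s t) atTop
      (𝓝 (remainder X Y Y' s t)) := fun s t =>
    ((hY t).sub (hY s)).sub (((ContinuousLinearMap.apply ℝ E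
      (X.path t - X.path s)).continuous.tendsto _).comp (hY' s))
  have hYB : IsControlledBy X ω M B Y Y' := by
    refine ⟨fun s => ?_, fun s t hst => ?_, fun s t hst => ?_⟩
    · exact le_of_tendsto' (hY' s).norm fun n => (p n).2.1.norm_deriv_le s
    · exact le_of_tendsto' ((hY' t).sub (hY' s)).norm fun n =>
        (p n).2.1.norm_deriv_sub_le s t hst
    · exact le_of_tendsto' (hrem s t).norm fun n => (p n).2.1.norm_remainder_le s t hst
  let q : S := ⟨(Y, Y'), hYB,
    tendsto_nhds_unique (hY o) (tendsto_const_nhds.congr fun n => (p n).2.2.1.symm),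
    tendsto_nhds_unique (hY' o) (tendsto_const_nhds.congr fun n => (p n).2.2.2.symm)⟩
  have hclose_lim : ∀ n, IsCloseBy X ω (2 * B * (1 / 2) ^ n) (p n).1.1 (p n).1.2 Y Y' := by
    intro n s t hst
    have hshift : Tendsto (fun k => n + k) atTop atTop :=
      tendsto_atTop_mono (fun k => Nat.le_add_left k n) tendsto_id
    constructor
    · exact le_of_tendsto' (tendsto_const_nhds.sub
        (((hY' t).sub (hY' s)).comp hshift)).norm fun k => (hclose n k s t hst).1
    · exact le_of_tendsto' (tendsto_const_nhds.sub ((hrem s t).comp hshift)).norm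
        fun k => (hclose n k s t hst).2
  -- The image of the limit is the limit of the shifted sequence, hence the limit itself.
  have hfix : ∀ n, IsCloseBy X ω (2 * B * (1 / 2) ^ n / 2) (p (n + 1)).1.1 (p (n + 1)).1.2
      (Φ q).1.1 (Φ q).1.2 := by
    intro n
    rw [hp]
    exact hcontr (b := q) (by positivity) (hclose_lim n)
  have hzero : ∀ {G : Type _} [NormedAddCommGroup G] (x : ℕ → G) (y z : G),
      Tendsto x atTop (𝓝 y) → (∀ n, ‖x (n + 1) - z‖ ≤ 2 * (2 * B * (1 / 2) ^ n) * δ) → z = y := by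
    intro G _ x y z hx hz
    refine tendsto_nhds_unique (tendsto_iff_norm_sub_tendsto_zero.2 ?_)
      (hx.comp (tendsto_add_atTop_nat 1))
    exact squeeze_zero (fun _ => norm_nonneg _) hz hlim₁
  have h1 : (Φ q).1.1 = Y := funext fun t => hzero _ _ _ (hY t) fun n => by
    refine (hpath (by positivity) (hfix n) t).1.trans ?_
    have : 0 ≤ B * (1 / 2) ^ n * δ := by positivity
    linarith
  have h2 : (Φ q).1.2 = Y' := funext fun t => hzero _ _ _ (hY' t) fun n => by
    refine (hpath (by positivity) (hfix n) t).2.trans ?_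
    have : 0 ≤ B * (1 / 2) ^ n * δ := by positivity
    linarith
  have := hΦ q
  rw [h1, h2] at this
  exact ⟨Y, Y', this, hYB⟩

end fixedPoint

/-! ### From `p`-variation to controls and back -/

lemma rpow_one_div_half {r x : ℝ} (hx : 0 ≤ x) : x ^ (1 / (r / 2)) = (x ^ (1 / r)) ^ 2 := by
  rw [← Real.rpow_natCast, ← Real.rpow_mul hx]
  congr 1
  push_cast
  ring

lemma pVar₂_le_of_norm_le_mul {ι E : Type*} [LinearOrder ι] [NormedAddCommGroup E]
    {Ξ : ι → ι → E} {ω : ι → ι → ℝ} (hω : IsControl ω) {p c b : ℝ} (hp : 0 < p) (hc : 0 ≤ c)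
    (hΞ : ∀ s t, s ≤ t → ‖Ξ s t‖ ≤ c * ω s t ^ (1 / p))
    (hb : ∀ s t, s ≤ t → ω s t ^ (1 / p) ≤ b) : pVar₂ p Ξ ≤ ENNReal.ofReal (c * b) := by
  have hpow : ∀ s t, (c ^ p * ω s t) ^ (1 / p) = c * ω s t ^ (1 / p) := fun s t => by
    rw [Real.mul_rpow (Real.rpow_nonneg hc _) (hω.nonneg s t), ← Real.rpow_mul hc,
      mul_one_div_cancel hp.ne', Real.rpow_one]
  refine pVar₂_le_of_control hp (hω.const_mul (Real.rpow_nonneg hc p)) (fun s t hst => ?_)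
    fun s t hst => ?_
  · rw [hpow]
    exact hΞ s t hst
  · rw [hpow]
    exact mul_le_mul_of_nonneg_left (hb s t hst) hc

section apriori

variable {r T : ℝ} {d : ℕ} {X : RoughPath r T d} {ω : Icc (0 : ℝ) T → Icc (0 : ℝ) T → ℝ}

lemma RoughPath.exists_dominatedBy (hr₂ : 2 ≤ r) {ε : ℝ} (hε : 0 ≤ ε) (hε1 : ε ≤ 1)
    (hX : pVar r X.path ≤ ENNReal.ofReal ε) (hA : pVar₂ (r / 2) X.area ≤ ENNReal.ofReal ε) :
    ∃ ω, X.DominatedBy ω ∧ ∀ s t, ω s t ≤ 2 * ε := by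
  have hr : 0 < r := by linarith
  have hr' : 0 < r / 2 := by linarith
  have c₁ := isControl_varControl hr X.path_var
  have c₂ := isControl_varControl hr' X.area_var
  refine ⟨_, ⟨c₁.add c₂, fun s t hst => ?_, fun s t hst => ?_⟩, fun s t => ?_⟩
  · exact (norm_le_varControl hr X.path_var hst).trans (Real.rpow_le_rpow (c₁.nonneg s t)
      (le_add_of_nonneg_right (c₂.nonneg s t)) (one_div_nonneg.2 hr.le))
  · rw [← rpow_one_div_half ((c₁.add c₂).nonneg s t)]
    exact (norm_le_varControl hr' X.area_var hst).trans (Real.rpow_le_rpow (c₂.nonneg s t)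
      (le_add_of_nonneg_left (c₁.nonneg s t)) (one_div_nonneg.2 hr'.le))
  · have h₁ := (varControl_le_rpow hr hε hX s t).trans
      (Real.rpow_le_self_of_le_one hε hε1 (by linarith))
    have h₂ := (varControl_le_rpow hr' hε hA s t).trans
      (Real.rpow_le_self_of_le_one hε hε1 (by linarith))
    linarith

variable {E : Type*} [NormedAddCommGroup E] [NormedSpace ℝ E]
  {φ : E → (EuclideanSpace ℝ (Fin d) →L[ℝ] E)} {M B δ : ℝ} {o : Icc (0 : ℝ) T} {y₀ : E}
  {Y : Icc (0 : ℝ) T → E} {Y' : Icc (0 : ℝ) T → (EuclideanSpace ℝ (Fin d) →L[ℝ] E)}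

/-- A path whose remainder is dominated by `ω` and whose derivative is `φ(Y)` is controlled with
a constant that depends only on the bound for `φ`. -/
lemma isControlledBy_of_norm_remainder_le {c : ℝ} (h : X.DominatedBy ω)
    (hω : ∀ s t, s ≤ t → ω s t ^ (1 / r) ≤ δ) (hφ : C21Bound φ M) (hY' : ∀ t, Y' t = φ (Y t))
    (hR : ∀ s t, s ≤ t → ‖remainder X Y Y' s t‖ ≤ c * (ω s t ^ (1 / r)) ^ 2) (hc : 0 ≤ c)
    (hcB : c ≤ B) (hB : M * (M + 1) ≤ B) (hcδ : c * δ ≤ 1) : IsControlledBy X ω M B Y Y' := by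
  have hM := hφ.one_le
  refine ⟨fun s => (hY' s) ▸ hφ.norm_le _, fun s t hst => ?_, fun s t hst =>
    (hR s t hst).trans (mul_le_mul_of_nonneg_right hcB (sq_nonneg _))⟩
  have h1 := hR s t hst
  have h2 := hω s t hst
  have h0 := h.rpow_nonneg s t
  have h3 := norm_apply_le_of_le (Y' s) _ (hY' s ▸ hφ.norm_le (Y s)) (h.norm_path_le s t hst)
  set w := ω s t ^ (1 / r)
  rw [hY' t, hY' s]
  refine (hφ.lipschitz _ _).trans ?_
  rw [sub_eq_remainder_add (X := X) (Y' := Y')]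
  calc _ ≤ M * (c * w ^ 2 + M * w) := by
        gcongr
        exact (norm_add_le _ _).trans (add_le_add h1 h3)
    _ = M * (M + c * w) * w := by ring
    _ ≤ M * (M + c * δ) * w := by gcongr
    _ ≤ M * (M + 1) * w := by gcongr
    _ ≤ B * w := by gcongr

/-- The a priori estimate. With respect to `κ = ω + ω_R`, where `ω_R` is the least control of the
remainder `R`, a solution is controlled with the constant `M (M + 1)`. The equation improves this to
`‖R‖ ^ (r/2) ≤ C κ ^ (3/2) + C' ω`. As `κ` is small, the right side is at most the control
`κ / 2 + C' ω`, and `ω_R`, being the least control, is at most a multiple of `ω`. -/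
theorem IsPicardStep.isControlledBy [CompleteSpace E] {A : ℝ}
    (hY : IsPicardStep X φ o y₀ Y Y' Y Y') (ho : ∀ t, o ≤ t) (hr₂ : 2 ≤ r) (hr₃ : r < 3)
    (hφ : C21Bound φ M) (h : X.DominatedBy ω) (hA : 0 ≤ A) (hA₁ : A ≤ 1 / 2) (hδA : δ ≤ A)
    (hω : ∀ s t, s ≤ t → ω s t ^ (1 / r) ≤ δ)
    (hvar : pVar₂ (r / 2) (remainder X Y Y') ≤ ENNReal.ofReal (A ^ 2))
    (hPA : (2 * picardConst r d M (M * (M + 1))) ^ (r / 2) * (2 * A) ≤ 1 / 2)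
    (hB₁ : 1 + 2 * (2 * ((d : ℝ) ^ 2 * M ^ 2)) ^ (r / 2) ≤ B) (hB₂ : M * (M + 1) ≤ B)
    (hBδ : B * δ ≤ 1) : IsControlledBy X ω M B Y Y' := by
  have hM := hφ.one_le
  have hr : 0 < r := by linarith
  have hr' : 0 < r / 2 := by linarith
  have hfin : pVar₂ (r / 2) (remainder X Y Y') < ∞ := hvar.trans_lt ENNReal.ofReal_lt_top
  have c₁ := isControl_varControl hr' hfin
  set V := varControl (r / 2) (remainder X Y Y')
  set κ : Icc (0 : ℝ) T → Icc (0 : ℝ) T → ℝ := fun s t => ω s t + V s t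
  have cκ : IsControl κ := h.isControl.add c₁
  have hωκ : ∀ s t, ω s t ≤ κ s t := fun s t => le_add_of_nonneg_right (c₁.nonneg s t)
  have hVκ : ∀ s t, V s t ≤ κ s t := fun s t => le_add_of_nonneg_left (h.isControl.nonneg s t)
  have hωκ' : ∀ s t, ω s t ^ (1 / r) ≤ κ s t ^ (1 / r) := fun s t =>
    Real.rpow_le_rpow (h.isControl.nonneg s t) (hωκ s t) (one_div_nonneg.2 hr.le)
  have hXκ : X.DominatedBy κ := ⟨cκ, fun s t hst => (h.norm_path_le s t hst).trans (hωκ' s t),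
    fun s t hst => (h.norm_area_le s t hst).trans
      (pow_le_pow_left₀ (h.rpow_nonneg s t) (hωκ' s t) 2)⟩
  have hκA : ∀ s t, s ≤ t → κ s t ≤ (2 * A) ^ 2 := by
    intro s t hst
    have hA2 : A ^ 2 ≤ 1 := by nlinarith
    have h1 : V s t ≤ A ^ 2 := (varControl_le_rpow hr' (sq_nonneg A) hvar s t).trans
      (Real.rpow_le_self_of_le_one (sq_nonneg A) hA2 (by linarith))
    have h2 : ω s t ≤ A ^ 2 := by
      have h3 := Real.rpow_le_rpow (h.rpow_nonneg s t) ((hω s t hst).trans hδA) hr.le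
      rw [← Real.rpow_mul (h.isControl.nonneg s t), one_div_mul_cancel hr.ne',
        Real.rpow_one] at h3
      refine h3.trans ?_
      rcases hA.eq_or_lt with rfl | hA0
      · rw [Real.zero_rpow hr.ne']
        norm_num
      · rw [← Real.rpow_two]
        exact Real.rpow_le_rpow_of_exponent_ge hA0 (by linarith) hr₂
    have : κ s t = ω s t + V s t := rfl
    nlinarith
  have hκ1 : ∀ s t, s ≤ t → κ s t ^ (1 / r) ≤ 1 := fun s t hst =>
    Real.rpow_le_one (cκ.nonneg s t) ((hκA s t hst).trans (by nlinarith))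
      (one_div_nonneg.2 hr.le)
  have hRκ : ∀ s t, s ≤ t → ‖remainder X Y Y' s t‖ ≤ 1 * (κ s t ^ (1 / r)) ^ 2 := by
    intro s t hst
    rw [one_mul, ← rpow_one_div_half (cκ.nonneg s t)]
    exact (norm_le_varControl hr' hfin hst).trans
      (Real.rpow_le_rpow (c₁.nonneg s t) (hVκ s t) (one_div_nonneg.2 hr'.le))
  have hYκ : IsControlledBy X κ M (M * (M + 1)) Y Y' :=
    isControlledBy_of_norm_remainder_le (δ := 1) hXκ hκ1 hφ (fun t => (hY t).2) hRκ
      zero_le_one (by nlinarith) le_rfl (by norm_num)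
  set P := picardConst r d M (M * (M + 1)) with hP
  have hP0 : 0 ≤ P := by
    have := sewingConst_three_div_nonneg hr₂ hr₃
    rw [hP, picardConst]
    positivity
  set Q : ℝ := (d : ℝ) ^ 2 * M ^ 2
  have hQ0 : 0 ≤ Q := by positivity
  -- The control that dominates the right side of the improved bound.
  have hV_le : ∀ s t, s ≤ t → V s t ≤ (1 + 2 * (2 * Q) ^ (r / 2)) * ω s t := by
    have c₂ : IsControl fun s t => (2 * P) ^ (r / 2) * (2 * A) * κ s t
        + (2 * Q) ^ (r / 2) * ω s t :=
      (cκ.const_mul (by positivity)).add (h.isControl.const_mul (by positivity))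
    have hle : ∀ s t, s ≤ t → ‖remainder X Y Y' s t‖ ≤ ((2 * P) ^ (r / 2) * (2 * A) * κ s t
        + (2 * Q) ^ (r / 2) * ω s t) ^ (1 / (r / 2)) := by
      intro s t hst
      have e1 := hY.norm_remainder_le ho hr₂ hr₃ hφ hYκ hXκ (by positivity) hκ1 hst
      have e2 := h.norm_area_le s t hst
      have hk := cκ.nonneg s t
      have hw := h.isControl.nonneg s t
      have e3 : ‖remainder X Y Y' s t‖
          ≤ max (2 * P * (κ s t ^ (1 / r)) ^ 3) (2 * Q * (ω s t ^ (1 / r)) ^ 2) := by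
        have e4 : Q * ‖X.area s t‖ ≤ Q * (ω s t ^ (1 / r)) ^ 2 :=
          mul_le_mul_of_nonneg_left e2 hQ0
        have e5 := le_max_left (2 * P * (κ s t ^ (1 / r)) ^ 3) (2 * Q * (ω s t ^ (1 / r)) ^ 2)
        have e6 := le_max_right (2 * P * (κ s t ^ (1 / r)) ^ 3) (2 * Q * (ω s t ^ (1 / r)) ^ 2)
        linarith
      have hkr : 0 ≤ κ s t ^ (1 / r) := Real.rpow_nonneg hk _
      have hwr : 0 ≤ ω s t ^ (1 / r) := Real.rpow_nonneg hw _
      have hrpow : ∀ x : ℝ, 0 ≤ x → ∀ n : ℕ,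
          ((x ^ (1 / r)) ^ n) ^ (r / 2) = x ^ ((n : ℝ) / 2) := by
        intro x hx n
        rw [← Real.rpow_natCast, ← Real.rpow_mul hx, ← Real.rpow_mul hx]
        congr 1
        field_simp
      refine e3.trans (max_le ?_ ?_)
      · rw [one_div (r / 2), Real.le_rpow_inv_iff_of_pos (by positivity) (c₂.nonneg s t) hr',
          Real.mul_rpow (by positivity) (by positivity), hrpow _ hk]
        have e7 : κ s t ^ (((3 : ℕ) : ℝ) / 2) ≤ 2 * A * κ s t := by
          have e8 : κ s t ^ ((1 : ℝ) / 2) ≤ 2 * A := by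
            rw [← Real.sqrt_eq_rpow]
            exact Real.sqrt_le_iff.2 ⟨by positivity, hκA s t hst⟩
          calc κ s t ^ (((3 : ℕ) : ℝ) / 2) = κ s t ^ ((1 : ℝ) / 2) * κ s t := by
                rw [show (((3 : ℕ) : ℝ) / 2) = 1 / 2 + 1 by norm_num,
                  Real.rpow_add_of_nonneg hk (by norm_num) zero_le_one, Real.rpow_one]
            _ ≤ _ := mul_le_mul_of_nonneg_right e8 hk
        calc _ ≤ (2 * P) ^ (r / 2) * (2 * A * κ s t) := by gcongr
          _ = (2 * P) ^ (r / 2) * (2 * A) * κ s t := by ring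
          _ ≤ _ := le_add_of_nonneg_right (by positivity)
      · rw [one_div (r / 2), Real.le_rpow_inv_iff_of_pos (by positivity) (c₂.nonneg s t) hr',
          Real.mul_rpow (by positivity) (by positivity), hrpow _ hw]
        have e7 : ω s t ^ (((2 : ℕ) : ℝ) / 2) = ω s t := by norm_num
        rw [e7]
        exact le_add_of_nonneg_left (by positivity)
    intro s t hst
    have e1 : V s t ≤ (2 * P) ^ (r / 2) * (2 * A) * κ s t + (2 * Q) ^ (r / 2) * ω s t :=
      varControl_le_of_control hr' c₂ hle s t
    have e2 : (2 * P) ^ (r / 2) * (2 * A) * κ s t ≤ 1 / 2 * κ s t :=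
      mul_le_mul_of_nonneg_right hPA (cκ.nonneg s t)
    have e3 : κ s t = ω s t + V s t := rfl
    rw [e3] at e1 e2
    linarith
  have hQr : 0 ≤ (2 * Q) ^ (r / 2) := by positivity
  set C := 1 + 2 * (2 * Q) ^ (r / 2)
  have hC1 : 1 ≤ C := by linarith
  have hδ0 : 0 ≤ δ := (h.rpow_nonneg o o).trans (hω o o le_rfl)
  refine isControlledBy_of_norm_remainder_le (c := C) h hω hφ (fun t => (hY t).2)
    (fun s t hst => ?_) (by linarith) hB₁ hB₂
    ((mul_le_mul_of_nonneg_right hB₁ hδ0).trans hBδ)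
  refine (norm_le_varControl hr' hfin hst).trans ?_
  have hw := h.isControl.nonneg s t
  calc V s t ^ (1 / (r / 2)) ≤ (C * ω s t) ^ (1 / (r / 2)) :=
        Real.rpow_le_rpow (c₁.nonneg s t) (hV_le s t hst) (one_div_nonneg.2 hr'.le)
    _ = C ^ (1 / (r / 2)) * (ω s t ^ (1 / r)) ^ 2 := by
        rw [Real.mul_rpow (by linarith) hw, rpow_one_div_half hw]
    _ ≤ C * (ω s t ^ (1 / r)) ^ 2 := by
        refine mul_le_mul_of_nonneg_right ?_ (sq_nonneg _)
        refine Real.rpow_le_self_of_one_le hC1 ?_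
        rw [div_le_one hr']
        linarith

end apriori

/-! ### Existence and uniqueness in the solution space -/

lemma lipNorm_le {E F : Type*} [NormedAddCommGroup E] [NormedSpace ℝ E]
    [NormedAddCommGroup F] [NormedSpace ℝ F] {φ : E → F} {M : ℝ} (hφ : C21Bound φ M) :
    lipNorm φ ≤ ENNReal.ofReal M := by
  refine iSup_le fun x => iSup_le fun y => ENNReal.div_le_of_le_mul ?_
  rw [← ofReal_norm, ← ofReal_norm, ← ENNReal.ofReal_mul (by linarith [hφ.one_le])]
  exact ENNReal.ofReal_le_ofReal (hφ.lipschitz x y)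

lemma isRDESolution_iff {r T : ℝ} (hT : 0 ≤ T) {d d' : ℕ}
    {φ : EuclideanSpace ℝ (Fin d') →
      (EuclideanSpace ℝ (Fin d) →L[ℝ] EuclideanSpace ℝ (Fin d'))}
    {X : RoughPath r T d} {y₀ : EuclideanSpace ℝ (Fin d')}
    {Y : ControlledPath X (EuclideanSpace ℝ (Fin d'))} :
    IsRDESolution hT φ X y₀ Y ↔
      IsPicardStep X φ ⟨0, le_rfl, hT⟩ y₀ Y.path Y.deriv Y.path Y.deriv := by
  refine forall_congr' fun t => and_congr_left fun _ => ⟨?_, fun h => ⟨_, h, by abel⟩⟩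
  rintro ⟨I, hI, hY⟩
  rwa [hY, add_sub_cancel_left]

theorem mainTheorem8 (r : ℝ) (hr₂ : 2 ≤ r) (hr₃ : r < 3) (d d' : ℕ)
    (φ : EuclideanSpace ℝ (Fin d') →
      (EuclideanSpace ℝ (Fin d) →L[ℝ] EuclideanSpace ℝ (Fin d')))
    (hφ : IsC21b φ) :
    ∃ A : ℝ≥0, 0 < A ∧ ∃ ε : ℝ≥0, 0 < ε ∧
      ∀ (T : ℝ) (hT : 0 ≤ T) (X : RoughPath r T d),
        pVar r X.path < ε → pVar₂ (r / 2) X.area < ε →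
        ∀ y₀ : EuclideanSpace ℝ (Fin d'),
          ∃! Y : ControlledPath X (EuclideanSpace ℝ (Fin d')),
            Y ∈ solutionSpace φ X A ∧ IsRDESolution hT φ X y₀ Y := by
  obtain ⟨M, hM⟩ := hφ.exists_bound
  have hM1 := hM.one_le
  have hr : 0 < r := by linarith
  have hs := sewingConst_three_div_nonneg hr₂ hr₃
  -- The constants are chosen in the order `B`, `A`, `δ`, `ε`.
  set Q : ℝ := (2 * ((d : ℝ) ^ 2 * M ^ 2)) ^ (r / 2)
  have hQ : 0 ≤ Q := by positivity
  set B : ℝ := 1 + (d : ℝ) ^ 2 * M ^ 2 + M * (M + 1) + 2 * Q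
  have hdM : 0 ≤ (d : ℝ) ^ 2 * M ^ 2 := by positivity
  have hMM : 0 ≤ M * (M + 1) := by positivity
  have hB0 : 0 ≤ B := by positivity
  set P : ℝ := (2 * picardConst r d M (M * (M + 1))) ^ (r / 2)
  have hP0 : 0 ≤ P := by
    refine Real.rpow_nonneg ?_ _
    unfold picardConst
    positivity
  set A : ℝ := 1 / (4 * P + 2) with hA
  have hA0 : 0 < A := by positivity
  have hA1 : A ≤ 1 / 2 := one_div_le_one_div_of_le two_pos (by linarith)
  have hPA : P * (2 * A) ≤ 1 / 2 := by
    rw [hA, ← mul_assoc, mul_one_div, div_le_iff₀ (by positivity)]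
    linarith
  set C : ℝ := contractionConst r d M B with hC
  have hC0 : 0 ≤ C := by
    rw [hC, contractionConst]
    positivity
  have hPC : picardConst r d M B ≤ C := by
    have h1 : 0 ≤ sewingConst (3 / r) * ((1 + (d : ℝ) ^ 2) * (7 * M ^ 2 * (M + B) ^ 2)) := by
      positivity
    have h2 : 0 ≤ 4 * M * (M + B) := by positivity
    rw [hC, contractionConst, picardConst]
    linarith
  set δ : ℝ := min (A / (M * (M + B))) (1 / (2 * C + 2))
  have hMB : 1 ≤ M + B := by linarith
  have hδ0 : 0 < δ := lt_min (by positivity) (by positivity)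
  have hMBδ : M * ((M + B) * δ) ≤ A := by
    have : δ ≤ A / (M * (M + B)) := min_le_left _ _
    rw [le_div_iff₀ (by positivity)] at this
    linarith
  have hMBδ' : (M + B) * δ ≤ A :=
    (le_mul_of_one_le_left (by positivity) hM1).trans hMBδ
  have hBδ : B * δ ≤ A :=
    (mul_le_mul_of_nonneg_right (by linarith) hδ0.le).trans hMBδ'
  have hδA : δ ≤ A := (le_mul_of_one_le_left hδ0.le hMB).trans hMBδ'
  have hCδ : C * δ ≤ 1 / 2 := by
    have : δ ≤ 1 / (2 * C + 2) := min_le_right _ _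
    rw [le_div_iff₀ (by positivity)] at this
    linarith
  have hPδ : picardConst r d M B * δ ≤ 1 :=
    (mul_le_mul_of_nonneg_right hPC hδ0.le).trans (by linarith)
  set ε : ℝ := δ ^ r / 2 with hε
  have hδr : δ ^ r ≤ 1 := Real.rpow_le_one hδ0.le (by linarith) hr.le
  have hδr0 : 0 < δ ^ r := Real.rpow_pos_of_pos hδ0 r
  refine ⟨A.toNNReal, Real.toNNReal_pos.2 hA0, ε.toNNReal, Real.toNNReal_pos.2 (by positivity),
    fun T hT X hX hXX y₀ => ?_⟩
  set o : Icc (0 : ℝ) T := ⟨0, le_rfl, hT⟩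
  have ho : ∀ t, o ≤ t := fun t => t.2.1
  obtain ⟨ω, h, hωε⟩ := X.exists_dominatedBy hr₂ (ε := ε) (by positivity) (by linarith) hX.le hXX.le
  have hω : ∀ s t, s ≤ t → ω s t ^ (1 / r) ≤ δ := by
    intro s t _
    rw [one_div, Real.rpow_inv_le_iff_of_pos (h.isControl.nonneg s t) hδ0.le hr]
    linarith [hωε s t]
  have hA2 : (ENNReal.ofNNReal A.toNNReal) ^ 2 = ENNReal.ofReal (A ^ 2) :=
    (ENNReal.ofReal_pow hA0.le 2).symm
  -- Solutions in the solution space are controlled by `ω`.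
  have hapriori : ∀ Y : ControlledPath X (EuclideanSpace ℝ (Fin d')),
      Y ∈ solutionSpace φ X A.toNNReal ∧ IsRDESolution hT φ X y₀ Y →
      IsControlledBy X ω M B Y.path Y.deriv := by
    rintro Y ⟨hYA, hYs⟩
    exact ((isRDESolution_iff hT).1 hYs).isControlledBy ho hr₂ hr₃ hM h hA0.le hA1 hδA hω
      (hYA.2.1.trans_eq hA2) hPA (by linarith) (by linarith) (by linarith)
  obtain ⟨W, W', hW, hWB⟩ := exists_isPicardStep_self (B := B) hr₂ hr₃ hM h ho
    (show δ ≤ 1 by linarith) hω (by linarith) (by linarith) (by linarith) hPδ hCδ y₀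
  have hvar' : pVar r W' ≤ ENNReal.ofReal (B * δ) :=
    pVar₂_le_of_norm_le_mul h.isControl hr hB0 hWB.norm_deriv_sub_le hω
  have hvarR : pVar₂ (r / 2) (remainder X W W') ≤ ENNReal.ofReal (B * δ ^ 2) := by
    refine pVar₂_le_of_norm_le_mul h.isControl (by positivity) hB0 (fun s t hst => ?_)
      fun s t hst => ?_
    · rw [rpow_one_div_half (h.isControl.nonneg s t)]
      exact hWB.norm_remainder_le s t hst
    · rw [rpow_one_div_half (h.isControl.nonneg s t)]
      exact pow_le_pow_left₀ (h.rpow_nonneg s t) (hω s t hst) 2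
  have hvar : pVar r W ≤ ENNReal.ofReal ((M + B) * δ) :=
    pVar₂_le_of_norm_le_mul h.isControl hr (by positivity) (fun s t hst =>
      hWB.norm_increment_le h hB0 (fun s t hst => (hω s t hst).trans (by linarith)) hst) hω
  let Y : ControlledPath X (EuclideanSpace ℝ (Fin d')) :=
    ⟨W, W', hvar'.trans_lt ENNReal.ofReal_lt_top, hvarR.trans_lt ENNReal.ofReal_lt_top⟩
  refine ⟨Y, ⟨⟨?_, ?_, ?_, ?_⟩, (isRDESolution_iff hT).2 hW⟩, fun V hV => ?_⟩
  · exact hvar'.trans (ENNReal.ofReal_le_ofReal hBδ)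
  · rw [hA2]
    refine hvarR.trans (ENNReal.ofReal_le_ofReal ?_)
    calc B * δ ^ 2 = B * δ * δ := by ring
      _ ≤ A * A := by gcongr
      _ = A ^ 2 := by ring
  · calc pVar r W ≤ ENNReal.ofReal (A / M) := hvar.trans (ENNReal.ofReal_le_ofReal (by
          rw [le_div_iff₀ (by positivity)]
          linarith))
      _ = ENNReal.ofReal A / ENNReal.ofReal M := ENNReal.ofReal_div_of_pos (by positivity)
      _ ≤ ENNReal.ofReal A / lipNorm φ := ENNReal.div_le_div_left (lipNorm_le hM) _
  · refine iSup_le fun t => ?_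
    change ‖W' t‖ₑ ≤ _
    rw [(hW t).2]
    exact le_iSup (fun y => ‖φ y‖ₑ) (W t)
  · obtain ⟨h1, h2⟩ := ((isRDESolution_iff hT).1 hV.2).unique hW hr₂ hr₃ hM (hapriori V hV) hWB h
      ho hB0 (show δ ≤ 1 by linarith) hω hCδ
    obtain ⟨VP, VD, _, _⟩ := V
    obtain rfl : VP = W := h1
    obtain rfl : VD = W' := h2
    rfl
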